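/- Let $\mathbb{H}$ be the quaternions, $\mathbb{S}=\{I\in\mathbb{H}: I^2=-1\}$, and for $x,y\in\mathbb{R}$ let $x+y\mathbb{S}=\{x+yI: I\in\mathbb{S}\}$. A symmetric slice domain is a domain $\Omega\subseteq\mathbb{H}$ that meets $\mathbb{R}$, meets each complex line $\mathbb{R}+I\mathbb{R}$ ($I\in\mathbb{S}$) in a domain of that line, and contains the whole sphere $x+y\mathbb{S}$ whenever it contains one of its points. A function $f$ on it is (slice) regular if every restriction $f_I$ of $f$ to $\Omega\cap(\mathbb{R}+I\mathbb{R})$ is $C^1$ with $\frac12\left(\frac{\partial}{\partial x}+I\frac{\partial}{\partial y}\right)f_I(x+yI)\equiv 0$. For regular $f,g$ with $f(x+yI)=\alpha+I\beta$, $g(x+yI)=\alpha'+I\beta'$ ($\alpha,\beta,\alpha',\beta'$ depending on $x,y$ but not on $I\in\mathbb{S}$), the $*$-product is $(f*g)(x+yI)=(\alpha\alpha'-\beta\beta')+I(\alpha\beta'+\beta\alpha')$, and $(q-p)^{*k}$, $k\in\mathbb{Z}$, denotes a power (for $k<0$, the reciprocal of $(q-p)^{*(-k)}$) with respect to $*$.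 For $p,q\in\mathbb{H}$ let $\sigma(q,p)=\tau(q,p)=|q-p|$ if $p,q$ lie on a common complex line $\mathbb{R}+I\mathbb{R}$; otherwise let $\sigma(q,p)$ and $\tau(q,p)$ be the square roots of $(\mathrm{Re}\,q-\mathrm{Re}\,p)^2+(|\mathrm{Im}\,q|\pm|\mathrm{Im}\,p|)^2$ with the sign $+$ and $-$ respectively. A point $p$ is a pole of a regular function $f$ on $\Omega'$ if for some $R>0$ the set $\{q:\tau(q,p)>0,\ \sigma(q,p)<R\}$ is contained in $\Omega'$ and $f$ has there a Laurent expansion $f(q)=\sum_{k\in\mathbb{Z}}(q-p)^{*k}a_k$, $a_k\in\mathbb{H}$, with only finitely many nonzero $a_k$, $k<0$ (possibly none). A function $f$ is semiregular in $\Omega$ if it is regular in a symmetric slice domain $\Omega'\subseteq\Omega$ such that every point of $\Omega\setminus\Omega'$ is a pole of $f$. **Theorem.** Let $f$ be a semiregular function on a symmetric slice domain $\Omega$, regular in $\Omega'\subseteq\Omega$ as above, suppose $f\not\equiv 0$ and let $x+y\mathbb{S}\subset\Omega$. There exist $m\in\mathbb{Z}$, $n\in\mathbb{N}$ (with $n=0$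 allowed) and $p_1,\dots,p_n\in x+y\mathbb{S}$ with $p_i\neq\bar p_{i+1}$ for all $i\in\{1,\dots,n-1\}$, such that $$f(q)=[(q-x)^2+y^2]^m\,(q-p_1)*(q-p_2)*\cdots*(q-p_n)*g(q)\qquad\text{for all } q\in\Omega',$$ for some function $g$ which is semiregular on $\Omega$, is regular in a symmetric slice domain $\Omega''$ with $\Omega'\cup(x+y\mathbb{S})\subseteq\Omega''\subseteq\Omega$ (all points of $\Omega\setminus\Omega''$ being poles of $g$), and has no zeros in $x+y\mathbb{S}$; thus $g$ has neither poles nor zeros in $x+y\mathbb{S}$. If $m\le 0$ we say that $f$ has spherical order $-2m$ at $x+y\mathbb{S}$; whenever $n>0$ we say that $f$ has isolated multiplicity $n$ at $p_1$. These notions are well defined: the spherical order (including whether it is defined), and the isolated multiplicity $n$ together with the point $p_1$ (including whether $n>0$), do not depend on the choice of the factorization. -/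

import Mathlib

open scoped Quaternion

noncomputable section

namespace SliceRegular

/-- The 2-sphere `𝕊` of imaginary units of `ℍ`. -/
def imagUnits : Set ℍ := {I | I ^ 2 = -1}

/-- The parametrization `a + i b ↦ a + b I` of the complex line `ℝ + I ℝ`. -/
def slice (I : ℍ) (z : ℂ) : ℍ := (z.re : ℍ) + (z.im : ℍ) * I

/-- `Ω_I = Ω ∩ (ℝ + I ℝ)`, in the coordinate `z = a + i b` on the line `ℝ + I ℝ`. -/
def sliceSet (I : ℍ) (Ω : Set ℍ) : Set ℂ := {z | slice I z ∈ Ω}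

/-- The sphere `x + y 𝕊` (a single point when `y = 0`). -/
def sphere (x y : ℝ) : Set ℍ := {q | ∃ I ∈ imagUnits, q = (x : ℍ) + (y : ℍ) * I}

/-- (Axially) symmetric sets. -/
def IsSymmetric (T : Set ℍ) : Prop :=
  ∀ x y : ℝ, ∀ I ∈ imagUnits, (x : ℍ) + (y : ℍ) * I ∈ T → sphere x y ⊆ T

/-- Symmetric slice domains: domains of `ℍ` that meet the real axis, are axially symmetric, and
meet every complex line `ℝ + I ℝ` in a domain of that line. -/
structure IsSymmetricSliceDomain (Ω : Set ℍ) : Prop where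
  isOpen : IsOpen Ω
  isConnected : IsConnected Ω
  meets_real : ∃ r : ℝ, (r : ℍ) ∈ Ω
  slice_isOpen : ∀ I ∈ imagUnits, IsOpen (sliceSet I Ω)
  slice_isConnected : ∀ I ∈ imagUnits, IsConnected (sliceSet I Ω)
  symmetric : IsSymmetric Ω

/-- The operator `½ (∂/∂x + I ∂/∂y)` applied to `f_I` at the point `z`. -/
def dbar (I : ℍ) (f : ℍ → ℍ) (z : ℂ) : ℍ :=
  (2 : ℍ)⁻¹ * (fderiv ℝ (fun w : ℂ => f (slice I w)) z 1 +
    I * fderiv ℝ (fun w : ℂ => f (slice I w)) z Complex.I)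

/-- (Slice) regular functions on an open set `Ω`: every restriction `f_I` is of class `C¹` and is
annihilated by `½ (∂/∂x + I ∂/∂y)`. Only the values of `f` on `Ω` matter. -/
def IsRegularOn (f : ℍ → ℍ) (Ω : Set ℍ) : Prop :=
  ∀ I ∈ imagUnits,
    ContDiffOn ℝ 1 (fun z : ℂ => f (slice I z)) (sliceSet I Ω) ∧
      ∀ z ∈ sliceSet I Ω, dbar I f z = 0

/-! ### The `*`-product, regular conjugate and regular reciprocal

A regular function on a symmetric slice domain is on each sphere of the form
`f (x + y I) = α (x, y) + I β (x, y)` with `α`, `β` independent of `I ∈ 𝕊`. Below `y = |Im q| ≥ 0`. -/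

/-- The imaginary unit `Im q / |Im q|` of `q` (and `0` if `q` is real). -/
def imUnit (q : ℍ) : ℍ := ‖q.im‖⁻¹ • q.im

/-- The component `α` of `f` at the sphere through `q`. -/
def stemRe (f : ℍ → ℍ) (q : ℍ) : ℍ := (2 : ℍ)⁻¹ * (f q + f (star q))

/-- The component `β` of `f` at the sphere through `q` (it is `0` at real points). -/
def stemIm (f : ℍ → ℍ) (q : ℍ) : ℍ := -((2 : ℍ)⁻¹ * (imUnit q * (f q - f (star q))))

/-- The `*`-product: `(α + I β) * (α' + I β') = (α α' - β β') + I (α β' + β α')`. -/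
def starMul (f g : ℍ → ℍ) (q : ℍ) : ℍ :=
  (stemRe f q * stemRe g q - stemIm f q * stemIm g q) +
    imUnit q * (stemRe f q * stemIm g q + stemIm f q * stemRe g q)

/-- The regular conjugate `f^c`, obtained by conjugating `α` and `β`. -/
def regConj (f : ℍ → ℍ) (q : ℍ) : ℍ :=
  star (stemRe f q) + imUnit q * star (stemIm f q)

/-- The symmetrization `f^s = f * f^c`. -/
def symmetrization (f : ℍ → ℍ) : ℍ → ℍ := starMul f (regConj f)

/-- The regular reciprocal `f^{-*} = (f^s)⁻¹ f^c`, meaningful off the zero set of `f^s`. -/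
def regRecip (f : ℍ → ℍ) (q : ℍ) : ℍ := (symmetrization f q)⁻¹ * regConj f q

/-- The `n`-th power with respect to `*`. -/
def starPow (f : ℍ → ℍ) : ℕ → ℍ → ℍ
  | 0 => fun _ => 1
  | n + 1 => starMul f (starPow f n)

/-- `(q - p)^{*n}` for `n ∈ ℤ`; for `n < 0` it is the regular reciprocal of `(q - p)^{*(-n)}`. -/
def starZPow (p : ℍ) : ℤ → ℍ → ℍ
  | Int.ofNat n => starPow (fun q => q - p) n
  | Int.negSucc n => regRecip (starPow (fun q => q - p) (n + 1))

/-- `(q - p₁) * (q - p₂) * ... * (q - pₙ) * g (q)`, all products being `*`-products. -/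
def starProd {n : ℕ} (p : Fin n → ℍ) (g : ℍ → ℍ) : ℍ → ℍ :=
  (List.ofFn p).foldr (fun a h => starMul (fun q => q - a) h) g

/-! ### Singularities -/

/-- `p` and `q` lie on a common complex line `ℝ + I ℝ`. -/
def SameLine (q p : ℍ) : Prop :=
  ∃ I ∈ imagUnits, q ∈ Set.range (slice I) ∧ p ∈ Set.range (slice I)

open Classical in
/-- The distance `σ`. -/
def sigma (q p : ℍ) : ℝ :=
  if SameLine q p then ‖q - p‖ else √((q.re - p.re) ^ 2 + (‖q.im‖ + ‖p.im‖) ^ 2)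

open Classical in
/-- The function `τ`. -/
def tau (q p : ℍ) : ℝ :=
  if SameLine q p then ‖q - p‖ else √((q.re - p.re) ^ 2 + (‖q.im‖ - ‖p.im‖) ^ 2)

/-- `Σ(p, R₁, R₂) = {q : τ(q, p) > R₁, σ(q, p) < R₂}`. -/
def sigmaShell (p : ℍ) (R₁ R₂ : ℝ) : Set ℍ := {q | R₁ < tau q p ∧ sigma q p < R₂}

/-- `p` is a pole (of some order `m ≥ 0`) of the function `f`, which is regular on `Ω`: some
`Σ(p, 0, R)` is contained in `Ω`, and the Laurent expansion `f (q) = ∑ (q - p)^{*n} a_n` valid there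
has `a_{-k} = 0` for all `k > m`. The only point of `Σ(p, 0, R)` on the sphere through `p` is (for
`R > 2 |Im p|`) the point `star p`, at which the terms with `n < 0` are defined by continuous
extension only; the expansion is required at all other points. -/
def IsPole (f : ℍ → ℍ) (Ω : Set ℍ) (p : ℍ) : Prop :=
  ∃ R : ℝ, 0 < R ∧ sigmaShell p 0 R ⊆ Ω ∧
    ∃ a : ℤ → ℍ,
      (∀ q ∈ sigmaShell p 0 R, q ≠ star p → HasSum (fun n : ℤ => starZPow p n q * a n) (f q)) ∧
      ∃ m : ℕ, ∀ k : ℤ, (m : ℤ) < k → a (-k) = 0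

/-- `f` is semiregular in `Ω`, with `Ω'` a symmetric slice domain in which it is regular, all points
of `Ω \ Ω'` being poles of `f`. Poles of order `0`, hence removable singularities, are allowed.
Only the values of `f` on `Ω'` matter. -/
structure IsSemiregularOn (f : ℍ → ℍ) (Ω' Ω : Set ℍ) : Prop where
  domain : IsSymmetricSliceDomain Ω'
  subset : Ω' ⊆ Ω
  regular : IsRegularOn f Ω'
  isPole : ∀ p ∈ Ω \ Ω', IsPole f Ω' p

/-! ### Spherical order and isolated multiplicity -/

/-- `f (q) = [(q - x)² + y²]^m (q - p₁) * ... * (q - pₙ) * g (q)` at all points of the domain `Ω'` of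
`f`, with `pᵢ ∈ x + y 𝕊`, with `pᵢ` different from the conjugate of `pᵢ₊₁`, and with `g` semiregular
in `Ω` and having neither poles nor zeros in `x + y 𝕊`. The set `Ω''` is the domain on which `g` is
defined and regular. -/
structure IsFactorization (f : ℍ → ℍ) (Ω' Ω : Set ℍ) (x y : ℝ) (m : ℤ) (n : ℕ) (p : Fin n → ℍ)
    (g : ℍ → ℍ) (Ω'' : Set ℍ) : Prop where
  mem_sphere : ∀ i, p i ∈ sphere x y
  ne_conj : ∀ (i : ℕ) (hi : i + 1 < n), p ⟨i, Nat.lt_of_succ_lt hi⟩ ≠ star (p ⟨i + 1, hi⟩)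
  semiregular : IsSemiregularOn g Ω'' Ω
  domain_subset : Ω' ⊆ Ω''
  no_poles : sphere x y ⊆ Ω''
  no_zeros : ∀ q ∈ sphere x y, g q ≠ 0
  eq : ∀ q ∈ Ω', f q = ((q - (x : ℍ)) ^ 2 + (y : ℍ) ^ 2) ^ m * starProd p g q

/-- `f` has spherical order `k` at `x + y 𝕊`: it has a factorization with `m ≤ 0` and `k = -2m`. -/
def HasSphericalOrder (f : ℍ → ℍ) (Ω' Ω : Set ℍ) (x y : ℝ) (k : ℤ) : Prop :=
  ∃ (m : ℤ) (n : ℕ) (p : Fin n → ℍ) (g : ℍ → ℍ) (Ω'' : Set ℍ),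
    IsFactorization f Ω' Ω x y m n p g Ω'' ∧ m ≤ 0 ∧ k = -2 * m

/-- `f` has isolated multiplicity `n` at `p₁ ∈ x + y 𝕊`: it has a factorization with `n > 0` factors
`q - pᵢ`, the first of which is `q - p₁`. -/
def HasIsolatedMultiplicity (f : ℍ → ℍ) (Ω' Ω : Set ℍ) (x y : ℝ) (n : ℕ) (p₁ : ℍ) : Prop :=
  ∃ (m : ℤ) (p : Fin n → ℍ) (g : ℍ → ℍ) (Ω'' : Set ℍ),
    IsFactorization f Ω' Ω x y m n p g Ω'' ∧ ∃ h : 0 < n, p ⟨0, h⟩ = p₁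

end SliceRegular

end

noncomputable section

namespace SliceRegular

open Complex (I)
open scoped ComplexConjugate

/-! ### Complexified quaternions -/

/-! Write `f = α + I β` on each sphere. Then `F = α + ι β` is a map from an open set of `ℂ` to `ℍ ⊗
ℂ`, the stem function. Slice regularity of `f` is holomorphy of `F` together with `F (conj z) =
cconj (F z)`, the `*`-product becomes the pointwise product (`stemOf_starMul`), and the sphere `x +
y 𝕊` becomes the conjugate pair `w = x + i y`, `conj w`. The complex quadratic form `normSq` is
multiplicative on `ℍ ⊗ ℂ`, and `normSq (F w) = 0` exactly when `f` has a zero on the sphere.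

Existence: a power of `quad = (z - x)² + y²` clears the poles at `w` and `conj w`; then one descends
on the order of `normSq ∘ F` at `w`. If `F w = 0`, divide by `quad`. If `F w` is a nonzero zero
divisor, some `a` on the sphere satisfies `(w - star a) F w = 0`; so `(z - star a) F = quad • G`,
that is, `F = (z - a) G`. Consecutive conjugate roots would produce a factor `quad` and force `F w =
0`. The order is finite by the identity theorem, since `normSq F = |f|²` on the real axis. At a real
point `F` takes a value in `ℍ`, where `normSq` is definite, and only powers of `z - x` occur
(`exists_stem_factorization`).

Uniqueness: the product `A = (z - p₁) ⋯ (z - pₙ) G` does not vanish at `w` when `y ≠ 0`, so `m` and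
`A w` are determined. Comparing `normSq A` gives `n`, and `p₁` is the only `a` with `(w - star a) A
w = 0` (`stem_factorization_unique`).

Semiregularity passes through the stem: on the line through a pole the `*`-powers are ordinary
powers, so poles of `f` correspond to meromorphy of `F` (`IsPole.exists_bound`,
`isPole_of_meromorphicAt`). -/

/-- The element `a + ι b` of `ℍ ⊗ ℂ`. -/
def cplx (a b : ℍ) : ℍ[ℂ] := ⟨⟨a.re, b.re⟩, ⟨a.imI, b.imI⟩, ⟨a.imJ, b.imJ⟩, ⟨a.imK, b.imK⟩⟩

/-- The component `a` of `a + ι b`. -/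
def rePart (w : ℍ[ℂ]) : ℍ := ⟨w.re.re, w.imI.re, w.imJ.re, w.imK.re⟩

/-- The component `b` of `a + ι b`. -/
def imPart (w : ℍ[ℂ]) : ℍ := ⟨w.re.im, w.imI.im, w.imJ.im, w.imK.im⟩

/-- The conjugation `a + ι b ↦ a - ι b`. -/
def cconj (w : ℍ[ℂ]) : ℍ[ℂ] := ⟨conj w.re, conj w.imI, conj w.imJ, conj w.imK⟩

/-- Evaluation `a + ι b ↦ a + J b`. -/
def ev (J : ℍ) (w : ℍ[ℂ]) : ℍ := rePart w + J * imPart w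

/-- The inclusion of the quaternions in their complexification. -/
def emb (a : ℍ) : ℍ[ℂ] := cplx a 0

section algebra

@[simp] lemma cplx_re (a b : ℍ) : (cplx a b).re = ⟨a.re, b.re⟩ := rfl
@[simp] lemma cplx_imI (a b : ℍ) : (cplx a b).imI = ⟨a.imI, b.imI⟩ := rfl
@[simp] lemma cplx_imJ (a b : ℍ) : (cplx a b).imJ = ⟨a.imJ, b.imJ⟩ := rfl
@[simp] lemma cplx_imK (a b : ℍ) : (cplx a b).imK = ⟨a.imK, b.imK⟩ := rfl
@[simp] lemma rePart_re (w : ℍ[ℂ]) : (rePart w).re = w.re.re := rfl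
@[simp] lemma rePart_imI (w : ℍ[ℂ]) : (rePart w).imI = w.imI.re := rfl
@[simp] lemma rePart_imJ (w : ℍ[ℂ]) : (rePart w).imJ = w.imJ.re := rfl
@[simp] lemma rePart_imK (w : ℍ[ℂ]) : (rePart w).imK = w.imK.re := rfl
@[simp] lemma imPart_re (w : ℍ[ℂ]) : (imPart w).re = w.re.im := rfl
@[simp] lemma imPart_imI (w : ℍ[ℂ]) : (imPart w).imI = w.imI.im := rfl
@[simp] lemma imPart_imJ (w : ℍ[ℂ]) : (imPart w).imJ = w.imJ.im := rfl
@[simp] lemma imPart_imK (w : ℍ[ℂ]) : (imPart w).imK = w.imK.im := rfl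
@[simp] lemma cconj_re (w : ℍ[ℂ]) : (cconj w).re = conj w.re := rfl
@[simp] lemma cconj_imI (w : ℍ[ℂ]) : (cconj w).imI = conj w.imI := rfl
@[simp] lemma cconj_imJ (w : ℍ[ℂ]) : (cconj w).imJ = conj w.imJ := rfl
@[simp] lemma cconj_imK (w : ℍ[ℂ]) : (cconj w).imK = conj w.imK := rfl

lemma rePart_cplx (a b : ℍ) : rePart (cplx a b) = a := rfl
lemma imPart_cplx (a b : ℍ) : imPart (cplx a b) = b := rfl
lemma cplx_rePart_imPart (w : ℍ[ℂ]) : cplx (rePart w) (imPart w) = w := rfl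

lemma rePart_mul (v w : ℍ[ℂ]) :
    rePart (v * w) = rePart v * rePart w - imPart v * imPart w := by
  ext <;> simp <;> ring

lemma imPart_mul (v w : ℍ[ℂ]) :
    imPart (v * w) = rePart v * imPart w + imPart v * rePart w := by
  ext <;> simp <;> ring

lemma rePart_cconj (w : ℍ[ℂ]) : rePart (cconj w) = rePart w := by ext <;> simp
lemma imPart_cconj (w : ℍ[ℂ]) : imPart (cconj w) = -imPart w := by ext <;> simp
lemma imPart_eq_zero_of_eq_cconj {w : ℍ[ℂ]} (h : w = cconj w) : imPart w = 0 := by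
  have h1 := congrArg imPart h
  rw [imPart_cconj] at h1
  have h2 : (2 : ℝ) • imPart w = 0 := by rw [two_smul]; exact eq_neg_iff_add_eq_zero.1 h1
  exact (smul_eq_zero.1 h2).resolve_left two_ne_zero

lemma rePart_star (w : ℍ[ℂ]) : rePart (star w) = star (rePart w) := by ext <;> simp
lemma imPart_star (w : ℍ[ℂ]) : imPart (star w) = star (imPart w) := by ext <;> simp

lemma ext_parts {v w : ℍ[ℂ]} (h₁ : rePart v = rePart w) (h₂ : imPart v = imPart w) : v = w := by
  rw [← cplx_rePart_imPart v, ← cplx_rePart_imPart w, h₁, h₂]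

lemma cconj_mul (v w : ℍ[ℂ]) : cconj (v * w) = cconj v * cconj w := by
  ext <;> simp

lemma cconj_sub (v w : ℍ[ℂ]) : cconj (v - w) = cconj v - cconj w := by ext <;> simp

lemma cconj_star (w : ℍ[ℂ]) : cconj (star w) = star (cconj w) := by ext <;> simp

lemma cconj_smul (c : ℂ) (w : ℍ[ℂ]) : cconj (c • w) = conj c • cconj w := by
  ext <;> simp

lemma cconj_emb (a : ℍ) : cconj (emb a) = emb a := by
  apply ext_parts
  · rw [rePart_cconj]
  · rw [imPart_cconj]; simp [emb, imPart_cplx]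

lemma cconj_coe (c : ℂ) : cconj (c : ℍ[ℂ]) = ((conj c : ℂ) : ℍ[ℂ]) := by
  ext <;> simp

lemma cconj_zero : cconj 0 = 0 := by ext <;> simp

lemma emb_star (a : ℍ) : emb (star a) = star (emb a) := by
  ext <;> simp [emb, Complex.ext_iff]

lemma emb_sub (a b : ℍ) : emb (a - b) = emb a - emb b := by
  ext <;> simp [emb, Complex.ext_iff]

lemma normSq_emb (a : ℍ) : Quaternion.normSq (emb a) = ((Quaternion.normSq a : ℝ) : ℂ) := by
  simp only [Quaternion.normSq_def', Complex.ext_iff, emb]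
  simp [pow_two]

/-- `ℍ ⊗ ℂ` has zero divisors, but a nonzero real quaternion stays invertible there because its
`normSq` is `|a|² ≠ 0`. -/
lemma emb_mul_eq_zero {a : ℍ} {w : ℍ[ℂ]} (ha : a ≠ 0) (h : emb a * w = 0) : w = 0 := by
  have h1 : star (emb a) * (emb a * w) = 0 := by rw [h, mul_zero]
  rw [← mul_assoc, Quaternion.star_mul_self, normSq_emb, Quaternion.coe_mul_eq_smul] at h1
  exact (smul_eq_zero.1 h1).resolve_left (by simpa using ha)

lemma mul_eq_zero_of_normSq_ne_zero {v w : ℍ[ℂ]} (hw : Quaternion.normSq w ≠ 0)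
    (h : v * w = 0) : v = 0 := by
  have h1 : v * w * star w = 0 := by rw [h, zero_mul]
  rw [mul_assoc, Quaternion.self_mul_star, Quaternion.mul_coe_eq_smul] at h1
  exact (smul_eq_zero.1 h1).resolve_left hw

end algebra

/-! ### Imaginary units and slices -/

lemma star_of_mem_imagUnits {J : ℍ} (hJ : J ∈ imagUnits) : star J = -J := by
  have h : J ^ 2 = -1 := hJ
  have hn : Quaternion.normSq J = 1 := by
    have h1 := congrArg Quaternion.normSq h
    rw [map_pow, Quaternion.normSq_neg, map_one] at h1
    nlinarith [Quaternion.normSq_nonneg (a := J)]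
  rw [Quaternion.star_eq_neg, ← Quaternion.sq_eq_neg_normSq, h, hn]
  simp

lemma mul_self_of_mem_imagUnits {J : ℍ} (hJ : J ∈ imagUnits) : J * J = -1 := by
  rw [← pow_two]; exact hJ

lemma re_of_mem_imagUnits {J : ℍ} (hJ : J ∈ imagUnits) : J.re = 0 :=
  Quaternion.star_eq_neg.1 (star_of_mem_imagUnits hJ)

lemma normSq_of_mem_imagUnits {J : ℍ} (hJ : J ∈ imagUnits) : Quaternion.normSq J = 1 := by
  have h := Quaternion.self_mul_star J
  rw [star_of_mem_imagUnits hJ, mul_neg, mul_self_of_mem_imagUnits hJ, neg_neg] at h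
  exact (Quaternion.coe_injective h).symm

lemma norm_of_mem_imagUnits {J : ℍ} (hJ : J ∈ imagUnits) : ‖J‖ = 1 := by
  have h := Quaternion.normSq_eq_norm_mul_self J
  rw [normSq_of_mem_imagUnits hJ] at h
  nlinarith [norm_nonneg J]

lemma mem_imagUnits_of_normSq {J : ℍ} (h : J.re = 0) (h1 : Quaternion.normSq J = 1) :
    J ∈ imagUnits := by
  change J ^ 2 = -1
  rw [Quaternion.sq_eq_neg_normSq.2 h, h1]; simp

lemma neg_mem_imagUnits {J : ℍ} (hJ : J ∈ imagUnits) : -J ∈ imagUnits := by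
  change (-J) ^ 2 = -1
  rw [neg_sq]; exact hJ

/-- The unit `i`. -/
def unitI : ℍ := ⟨0, 1, 0, 0⟩

lemma unitI_mem : unitI ∈ imagUnits :=
  mem_imagUnits_of_normSq rfl (by rw [Quaternion.normSq_def']; simp [unitI])

/-- The embedding of `ℂ` onto a complex line as a ring homomorphism. -/
def sliceHom {J : ℍ} (hJ : J ∈ imagUnits) : ℂ →+* ℍ where
  toFun := slice J
  map_one' := by simp [slice]
  map_zero' := by simp [slice]
  map_add' z w := by simp only [slice, Complex.add_re, Complex.add_im, Quaternion.coe_add]; noncomm_ring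
  map_mul' z w := by
    have h := mul_self_of_mem_imagUnits hJ
    simp only [slice, Complex.mul_re, Complex.mul_im, Quaternion.coe_sub, Quaternion.coe_add,
      Quaternion.coe_mul_eq_smul]
    simp only [mul_add, add_mul, smul_mul_assoc, mul_smul_comm, h, Quaternion.coe_mul_eq_smul,
      smul_smul, ← Quaternion.coe_commutes (R := ℝ) _ J]
    ext <;> simp <;> ring

@[simp] lemma sliceHom_apply {J : ℍ} (hJ : J ∈ imagUnits) (z : ℂ) : sliceHom hJ z = slice J z := rfl

lemma slice_mul {J : ℍ} (hJ : J ∈ imagUnits) (z w : ℂ) :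
    slice J (z * w) = slice J z * slice J w := map_mul (sliceHom hJ) z w

lemma slice_sub (J : ℍ) (z w : ℂ) : slice J (z - w) = slice J z - slice J w := by
  simp only [slice, Complex.sub_re, Complex.sub_im, Quaternion.coe_sub]; noncomm_ring

lemma star_slice {J : ℍ} (hJ : J ∈ imagUnits) (z : ℂ) : star (slice J z) = slice J (conj z) := by
  have := star_of_mem_imagUnits hJ
  simp [slice, this, Quaternion.coe_commutes]

lemma slice_neg (J : ℍ) (z : ℂ) : slice (-J) z = slice J (conj z) := by
  simp [slice]

lemma slice_ofReal (J : ℍ) (r : ℝ) : slice J (r : ℂ) = r := by simp [slice]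

lemma slice_re {J : ℍ} (hJ : J ∈ imagUnits) (z : ℂ) : (slice J z).re = z.re := by
  simp [slice, re_of_mem_imagUnits hJ]

lemma slice_im {J : ℍ} (hJ : J ∈ imagUnits) (z : ℂ) : (slice J z).im = z.im • J := by
  have := re_of_mem_imagUnits hJ
  ext <;> simp [slice, this]

lemma norm_slice_im {J : ℍ} (hJ : J ∈ imagUnits) (z : ℂ) : ‖(slice J z).im‖ = |z.im| := by
  rw [slice_im hJ, norm_smul, norm_of_mem_imagUnits hJ, mul_one, Real.norm_eq_abs]

lemma norm_slice {J : ℍ} (hJ : J ∈ imagUnits) (z : ℂ) : ‖slice J z‖ = ‖z‖ := by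
  have h : Quaternion.normSq (slice J z) = Complex.normSq z := by
    have := Quaternion.self_mul_star (slice J z)
    rw [star_slice hJ, ← slice_mul hJ, Complex.mul_conj, slice_ofReal] at this
    exact (Quaternion.coe_injective this).symm
  rw [Quaternion.normSq_eq_norm_mul_self, Complex.normSq_eq_norm_sq, ← pow_two] at h
  exact (sq_eq_sq₀ (norm_nonneg _) (norm_nonneg _)).1 h

lemma slice_injective {J : ℍ} (hJ : J ∈ imagUnits) : Function.Injective (slice J) :=
  (sliceHom hJ).injective

lemma mul_comm_slice {J : ℍ} (z : ℂ) : J * slice J z = slice J z * J := by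
  rw [slice, mul_add, add_mul, ← Quaternion.coe_commutes, ← mul_assoc, ← Quaternion.coe_commutes]

/-- The coordinate of `q` in its complex line, in the closed upper half-plane. -/
def coordOf (q : ℍ) : ℂ := ⟨q.re, ‖q.im‖⟩

lemma exists_slice (q : ℍ) : ∃ J ∈ imagUnits, slice J (coordOf q) = q := by
  by_cases h : q.im = 0
  · refine ⟨unitI, unitI_mem, ?_⟩
    have h2 := Quaternion.re_add_im q
    rw [h] at h2
    simp only [slice, coordOf, h, norm_zero, Quaternion.coe_zero, zero_mul]
    exact h2
  · have hn : ‖q.im‖ ≠ 0 := norm_ne_zero_iff.2 h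
    refine ⟨imUnit q, mem_imagUnits_of_normSq (by simp [imUnit]) ?_, ?_⟩
    · rw [imUnit, Quaternion.normSq_smul, Quaternion.normSq_eq_norm_mul_self]; field_simp
    · simp only [slice, coordOf, imUnit, Quaternion.coe_mul_eq_smul, smul_smul]
      rw [mul_inv_cancel₀ hn, one_smul]
      exact Quaternion.re_add_im q

lemma coordOf_slice {J : ℍ} (hJ : J ∈ imagUnits) (z : ℂ) :
    coordOf (slice J z) = ⟨z.re, |z.im|⟩ := by
  simp [coordOf, slice_re hJ, norm_slice_im hJ]

/-- `imUnit` always points into the upper half-plane: it gives `-J` below the real axis and `0` on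
it. This is the source of the signs below. -/
lemma imUnit_slice {J : ℍ} (hJ : J ∈ imagUnits) (z : ℂ) :
    imUnit (slice J z) = (SignType.sign z.im : ℝ) • J := by
  rw [imUnit, norm_slice_im hJ, slice_im hJ, smul_smul]
  congr 1
  rcases lt_trichotomy z.im 0 with h | h | h
  · rw [abs_of_neg h, sign_neg h]; simp; field_simp [h.ne]
  · simp [h]
  · rw [abs_of_pos h, sign_pos h]; simp; field_simp

/-! ### Evaluation of complexified quaternions -/

lemma ev_add (J : ℍ) (v w : ℍ[ℂ]) : ev J (v + w) = ev J v + ev J w := by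
  have h1 : rePart (v + w) = rePart v + rePart w := by ext <;> simp
  have h2 : imPart (v + w) = imPart v + imPart w := by ext <;> simp
  rw [ev, ev, ev, h1, h2]; noncomm_ring

lemma ev_cconj (J : ℍ) (w : ℍ[ℂ]) : ev J (cconj w) = ev (-J) w := by
  rw [ev, ev, rePart_cconj, imPart_cconj]; noncomm_ring

lemma ev_smul {J : ℍ} (hJ : J ∈ imagUnits) (c : ℂ) (w : ℍ[ℂ]) :
    ev J (c • w) = slice J c * ev J w := by
  have h1 : rePart (c • w) = c.re • rePart w - c.im • imPart w := by ext <;> simp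
  have h2 : imPart (c • w) = c.re • imPart w + c.im • rePart w := by ext <;> simp
  have h := mul_self_of_mem_imagUnits hJ
  rw [ev, ev, h1, h2, slice]
  simp only [Quaternion.coe_mul_eq_smul, mul_add, add_mul, smul_mul_assoc, mul_smul_comm,
    ← mul_assoc, h]
  simp only [neg_mul, one_mul, smul_neg]
  abel

lemma ev_coe {J : ℍ} (hJ : J ∈ imagUnits) (c : ℂ) : ev J (c : ℍ[ℂ]) = slice J c := by
  have := ev_smul hJ c 1
  have h1 : ev J (1 : ℍ[ℂ]) = 1 := by
    have h1 : rePart (1 : ℍ[ℂ]) = 1 := by ext <;> simp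
    have h2 : imPart (1 : ℍ[ℂ]) = 0 := by ext <;> simp
    rw [ev, h1, h2]; simp
  rw [h1, mul_one] at this
  rw [← this, ← Quaternion.mul_coe_eq_smul, one_mul]

lemma ev_emb (J a : ℍ) : ev J (emb a) = a := by
  simp [ev, emb, rePart_cplx, imPart_cplx]

lemma ev_sub (J : ℍ) (v w : ℍ[ℂ]) : ev J (v - w) = ev J v - ev J w := by
  rw [eq_sub_iff_add_eq, ← ev_add, sub_add_cancel]

/-- Evaluation at `J` is multiplicative if the left factor commutes with `J`. -/
lemma ev_mul_of_commute {J : ℍ} (hJ : J ∈ imagUnits) {v : ℍ[ℂ]} (h₁ : Commute J (rePart v))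
    (h₂ : Commute J (imPart v)) (w : ℍ[ℂ]) : ev J (v * w) = ev J v * ev J w := by
  have h := mul_self_of_mem_imagUnits hJ
  have e1 : J * (rePart v * imPart w) = rePart v * (J * imPart w) := by
    rw [← mul_assoc, h₁.eq, mul_assoc]
  have e2 : J * imPart v * (J * imPart w) = - (imPart v * imPart w) := by
    rw [h₂.eq, mul_assoc, ← mul_assoc J, h]; noncomm_ring
  rw [ev, ev, ev, rePart_mul, imPart_mul, mul_add, e1, mul_add, add_mul, add_mul, e2]
  noncomm_ring

lemma ext_ev {J : ℍ} (hJ : J ∈ imagUnits) {v w : ℍ[ℂ]} (h₁ : ev J v = ev J w)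
    (h₂ : ev (-J) v = ev (-J) w) : v = w := by
  have h0 : J ≠ 0 := by rintro rfl; simp [imagUnits] at hJ
  have hr : (2 : ℝ) • rePart v = (2 : ℝ) • rePart w := by
    have := congrArg₂ (· + ·) h₁ h₂
    simp only [ev] at this
    rw [two_smul, two_smul]
    convert this using 1 <;> noncomm_ring
  have hr' : rePart v = rePart w := smul_right_injective _ (two_ne_zero (α := ℝ)) hr
  refine ext_parts hr' ?_
  simp only [ev, hr'] at h₁
  exact mul_left_cancel₀ h0 (add_left_cancel h₁)

/-- If `ev J w = 0` then `(J + ι) w = 0` with `J + ι ≠ 0`, so `w` is a zero divisor. -/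
lemma ev_ne_zero_of_normSq_ne_zero {J : ℍ} (hJ : J ∈ imagUnits) {w : ℍ[ℂ]}
    (hw : Quaternion.normSq w ≠ 0) : ev J w ≠ 0 := by
  intro h
  have h1 : cplx J 1 * w = 0 := by
    have hr : rePart w = -(J * imPart w) := eq_neg_of_add_eq_zero_left h
    apply ext_parts
    · rw [rePart_mul, rePart_cplx, imPart_cplx, hr, mul_neg, ← mul_assoc,
        mul_self_of_mem_imagUnits hJ]
      ext <;> simp
    · rw [imPart_mul, rePart_cplx, imPart_cplx, hr]
      ext <;> simp
  have h2 := mul_eq_zero_of_normSq_ne_zero hw h1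
  have h3 := congrArg imPart h2
  rw [imPart_cplx] at h3
  simpa using congrArg QuaternionAlgebra.re h3

/-- For `w = a + ι b` the norm is `|a|² - |b|² + 2 i ⟨a, b⟩`. Its vanishing makes `a` and `b`
orthogonal of equal length, so `-a b⁻¹` is an imaginary unit when `b ≠ 0`; when `b = 0` also `a = 0`
and any unit serves. -/
lemma exists_ev_eq_zero {w : ℍ[ℂ]} (hw : Quaternion.normSq w = 0) :
    ∃ J ∈ imagUnits, ev J w = 0 := by
  have h1 : Quaternion.normSq (rePart w) = Quaternion.normSq (imPart w) := by
    have := congrArg Complex.re hw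
    simp only [Quaternion.normSq_def', Complex.add_re, pow_two, Complex.mul_re, Complex.zero_re]
      at this ⊢
    simp only [rePart_re, rePart_imI, rePart_imJ, rePart_imK, imPart_re, imPart_imI, imPart_imJ,
      imPart_imK]
    linarith
  have h2 : (rePart w * star (imPart w)).re = 0 := by
    have := congrArg Complex.im hw
    simp only [Quaternion.normSq_def', Complex.add_im, pow_two, Complex.mul_im, Complex.zero_im]
      at this
    simp
    linarith
  by_cases h : imPart w = 0
  · refine ⟨unitI, unitI_mem, ?_⟩
    rw [h, map_zero, Quaternion.normSq_eq_zero] at h1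
    rw [ev, h, h1]; simp
  · refine ⟨-(rePart w * (imPart w)⁻¹), mem_imagUnits_of_normSq ?_ ?_, ?_⟩
    · rw [Quaternion.inv_def]
      simp only [mul_smul_comm, Quaternion.re_neg, Quaternion.re_smul, h2]
      simp
    · rw [Quaternion.normSq_neg, map_mul, map_inv₀, h1, mul_inv_cancel₀]
      exact Quaternion.normSq_ne_zero.2 h
    · rw [ev, neg_mul, mul_assoc, inv_mul_cancel₀ h]; simp

/-! ### Stem functions of functions on `ℍ` -/

/-- The stem function `α + ι β` of `f`, computed on the complex line `ℝ + J ℝ`. -/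
def stemOf (f : ℍ → ℍ) (J : ℍ) (z : ℂ) : ℍ[ℂ] :=
  cplx ((2⁻¹ : ℝ) • (f (slice J z) + f (slice J (conj z))))
    (-((2⁻¹ : ℝ) • (J * (f (slice J z) - f (slice J (conj z))))))

lemma ev_stemOf (f : ℍ → ℍ) {J : ℍ} (hJ : J ∈ imagUnits) (z : ℂ) :
    ev J (stemOf f J z) = f (slice J z) := by
  rw [ev, stemOf, rePart_cplx, imPart_cplx, mul_neg, mul_smul_comm, ← mul_assoc,
    mul_self_of_mem_imagUnits hJ]
  ext <;> simp <;> ring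

lemma stemOf_conj (f : ℍ → ℍ) (J : ℍ) (z : ℂ) :
    stemOf f J (conj z) = cconj (stemOf f J z) := by
  apply ext_parts
  · rw [rePart_cconj, stemOf, stemOf, rePart_cplx, rePart_cplx, Complex.conj_conj, add_comm]
  · rw [imPart_cconj, stemOf, stemOf, imPart_cplx, imPart_cplx, Complex.conj_conj, neg_neg,
      ← smul_neg, ← mul_neg, neg_sub]

lemma stemOf_eq {f : ℍ → ℍ} {J : ℍ} (hJ : J ∈ imagUnits) {z : ℂ} {w : ℍ[ℂ]}
    (h₁ : f (slice J z) = ev J w) (h₂ : f (slice J (conj z)) = ev J (cconj w)) :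
    stemOf f J z = w := by
  apply ext_ev hJ
  · rw [ev_stemOf f hJ, h₁]
  · rw [← ev_cconj, ← stemOf_conj, ev_stemOf f hJ, h₂, ev_cconj]

lemma two_inv_mul (q : ℍ) : (2 : ℍ)⁻¹ * q = (2⁻¹ : ℝ) • q := by
  rw [← Quaternion.coe_mul_eq_smul, Quaternion.coe_inv]; rfl

lemma stemRe_slice (f : ℍ → ℍ) {J : ℍ} (hJ : J ∈ imagUnits) (z : ℂ) :
    stemRe f (slice J z) = rePart (stemOf f J z) := by
  rw [stemRe, star_slice hJ, two_inv_mul, stemOf, rePart_cplx]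

lemma stemIm_slice (f : ℍ → ℍ) {J : ℍ} (hJ : J ∈ imagUnits) (z : ℂ) :
    stemIm f (slice J z) = (SignType.sign z.im : ℝ) • imPart (stemOf f J z) := by
  rw [stemIm, star_slice hJ, two_inv_mul, stemOf, imPart_cplx, imUnit_slice hJ, smul_mul_assoc,
    smul_neg, smul_comm]

lemma imPart_stemOf_of_im_eq_zero (f : ℍ → ℍ) (J : ℍ) {z : ℂ} (hz : z.im = 0) :
    imPart (stemOf f J z) = 0 := by
  rw [stemOf, imPart_cplx, Complex.conj_eq_iff_im.2 hz]; simp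

lemma sign_smul_sign_smul_imPart (f : ℍ → ℍ) (J : ℍ) (z : ℂ) :
    (SignType.sign z.im : ℝ) • (SignType.sign z.im : ℝ) • imPart (stemOf f J z) =
      imPart (stemOf f J z) := by
  rcases lt_trichotomy z.im 0 with h | h | h
  · rw [sign_neg h]; simp
  · rw [imPart_stemOf_of_im_eq_zero f J h]; simp
  · rw [sign_pos h]; simp

/-- The signs carried by `stemIm` and `imUnit` cancel in pairs off the real axis, and on it the
imaginary parts vanish. -/
lemma starMul_slice (f g : ℍ → ℍ) {J : ℍ} (hJ : J ∈ imagUnits) (z : ℂ) :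
    starMul f g (slice J z) = ev J (stemOf f J z * stemOf g J z) := by
  rw [starMul, stemRe_slice f hJ, stemRe_slice g hJ, stemIm_slice f hJ, stemIm_slice g hJ,
    imUnit_slice hJ, ev, rePart_mul, imPart_mul]
  rcases lt_trichotomy z.im 0 with h | h | h
  · rw [sign_neg h]; simp; noncomm_ring
  · simp [imPart_stemOf_of_im_eq_zero _ J h]
  · rw [sign_pos h]; simp

lemma stemOf_starMul (f g : ℍ → ℍ) {J : ℍ} (hJ : J ∈ imagUnits) (z : ℂ) :
    stemOf (starMul f g) J z = stemOf f J z * stemOf g J z := by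
  apply stemOf_eq hJ (starMul_slice f g hJ z)
  rw [starMul_slice f g hJ, stemOf_conj, stemOf_conj, cconj_mul]

lemma regConj_slice (f : ℍ → ℍ) {J : ℍ} (hJ : J ∈ imagUnits) (z : ℂ) :
    regConj f (slice J z) = ev J (star (stemOf f J z)) := by
  rw [regConj, stemRe_slice f hJ, stemIm_slice f hJ, imUnit_slice hJ, ev, rePart_star, imPart_star,
    Quaternion.star_smul, smul_mul_assoc, mul_smul_comm, ← mul_smul_comm, ← mul_smul_comm,
    ← Quaternion.star_smul, ← Quaternion.star_smul, sign_smul_sign_smul_imPart]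

lemma stemOf_regConj (f : ℍ → ℍ) {J : ℍ} (hJ : J ∈ imagUnits) (z : ℂ) :
    stemOf (regConj f) J z = star (stemOf f J z) := by
  apply stemOf_eq hJ (regConj_slice f hJ z)
  rw [regConj_slice f hJ, stemOf_conj, cconj_star]

lemma stemOf_sub_const (p : ℍ) {J : ℍ} (hJ : J ∈ imagUnits) (z : ℂ) :
    stemOf (fun q => q - p) J z = (z : ℍ[ℂ]) - emb p := by
  apply stemOf_eq hJ
  · rw [ev_sub, ev_coe hJ, ev_emb]
  · rw [cconj_sub, cconj_coe, cconj_emb, ev_sub, ev_coe hJ, ev_emb]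

/-- The stem function of the `*`-product of the polynomials `q - a`, `a ∈ l`. -/
def prodL (l : List ℍ) (z : ℂ) : ℍ[ℂ] := (l.map fun a => (z : ℍ[ℂ]) - emb a).prod

@[simp] lemma prodL_nil (z : ℂ) : prodL [] z = 1 := rfl

@[simp] lemma prodL_cons (a : ℍ) (l : List ℍ) (z : ℂ) :
    prodL (a :: l) z = ((z : ℍ[ℂ]) - emb a) * prodL l z := by simp [prodL]

lemma stemOf_starProd {n : ℕ} (p : Fin n → ℍ) (g : ℍ → ℍ) {J : ℍ} (hJ : J ∈ imagUnits) (z : ℂ) :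
    stemOf (starProd p g) J z = prodL (List.ofFn p) z * stemOf g J z := by
  rw [starProd]
  induction List.ofFn p with
  | nil => simp
  | cons a l ih => rw [List.foldr_cons, stemOf_starMul _ _ hJ, stemOf_sub_const a hJ, ih, prodL_cons,
      mul_assoc]

open Filter Topology

/-! ### Division of holomorphic stem functions, and zero divisors at a sphere -/

section

/-! ### Holomorphic stem functions -/

/-- The coordinates of a complexified quaternion. -/
def coord (i : Fin 4) (w : ℍ[ℂ]) : ℂ := Quaternion.equivTuple ℂ w i

@[simp] lemma coord_zero (w : ℍ[ℂ]) : coord 0 w = w.re := rfl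
@[simp] lemma coord_one (w : ℍ[ℂ]) : coord 1 w = w.imI := rfl
@[simp] lemma coord_two (w : ℍ[ℂ]) : coord 2 w = w.imJ := rfl
@[simp] lemma coord_three (w : ℍ[ℂ]) : coord 3 w = w.imK := rfl

lemma ext_coord {v w : ℍ[ℂ]} (h : ∀ i, coord i v = coord i w) : v = w :=
  Quaternion.ext _ _ (h 0) (h 1) (h 2) (h 3)

lemma coord_smul (i : Fin 4) (c : ℂ) (w : ℍ[ℂ]) : coord i (c • w) = c * coord i w := by
  fin_cases i <;> simp

lemma coord_cconj (i : Fin 4) (w : ℍ[ℂ]) : coord i (cconj w) = conj (coord i w) := by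
  fin_cases i <;> simp

lemma coord_equivTuple_symm (i : Fin 4) (a : Fin 4 → ℂ) :
    coord i ((Quaternion.equivTuple ℂ).symm a) = a i := by
  rw [coord, Equiv.apply_symm_apply]

/-- By Hamilton's multiplication table, any property of scalar functions closed under sums,
differences and products passes to the coordinates of a product. It is applied to differentiability,
continuity and meromorphy. -/
lemma coord_mul_induction {Q : (ℂ → ℂ) → Prop} (hadd : ∀ f g, Q f → Q g → Q (f + g))
    (hsub : ∀ f g, Q f → Q g → Q (f - g)) (hmul : ∀ f g, Q f → Q g → Q (f * g))
    {F G : ℂ → ℍ[ℂ]} (hF : ∀ i, Q fun z => coord i (F z)) (hG : ∀ i, Q fun z => coord i (G z))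
    (i : Fin 4) : Q fun z => coord i (F z * G z) := by
  have h := fun j k => hmul _ _ (hF j) (hG k)
  fin_cases i
  · convert hsub _ _ (hsub _ _ (hsub _ _ (h 0 0) (h 1 1)) (h 2 2)) (h 3 3) using 1
    ext z; simp
  · convert hsub _ _ (hadd _ _ (hadd _ _ (h 0 1) (h 1 0)) (h 2 3)) (h 3 2) using 1
    ext z; simp
  · convert hadd _ _ (hadd _ _ (hsub _ _ (h 0 2) (h 1 3)) (h 2 0)) (h 3 1) using 1
    ext z; simp
  · convert hadd _ _ (hsub _ _ (hadd _ _ (h 0 3) (h 1 2)) (h 2 1)) (h 3 0) using 1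
    ext z; simp

/-- Holomorphic stem functions on `D`. -/
structure IsStemOn (F : ℂ → ℍ[ℂ]) (D : Set ℂ) : Prop where
  diff : ∀ i, DifferentiableOn ℂ (fun z => coord i (F z)) D
  map_conj : ∀ z ∈ D, F (conj z) = cconj (F z)

variable {D : Set ℂ} {F G : ℂ → ℍ[ℂ]} {x y : ℝ}

lemma IsStemOn.mul (hF : IsStemOn F D) (hG : IsStemOn G D) :
    IsStemOn (fun z => F z * G z) D where
  diff := coord_mul_induction (Q := fun f => DifferentiableOn ℂ f D) (fun _ _ h h' => h.add h')
    (fun _ _ h h' => h.sub h') (fun _ _ h h' => h.mul h') hF.diff hG.diff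
  map_conj z hz := by rw [hF.map_conj z hz, hG.map_conj z hz, cconj_mul]

lemma isStemOn_sub_emb (a : ℍ) : IsStemOn (fun z : ℂ => (z : ℍ[ℂ]) - emb a) D where
  diff i := by 
    fin_cases i <;> simp
    exact differentiableOn_id
  map_conj z _ := by rw [cconj_sub, cconj_coe, cconj_emb]

lemma IsStemOn.differentiableOn_normSq (hF : IsStemOn F D) :
    DifferentiableOn ℂ (fun z => Quaternion.normSq (F z)) D := by
  simp only [Quaternion.normSq_def']
  exact ((((hF.diff 0).pow 2).add ((hF.diff 1).pow 2)).add ((hF.diff 2).pow 2)).add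
    ((hF.diff 3).pow 2)

/-- The quotients `k i` need not respect conjugation. Averaging each with `conj ∘ k i ∘ conj`
restores the symmetry and is still a quotient, because `p` and `F` are symmetric. -/
lemma exists_stem_div {p : ℂ → ℂ} (hD : IsOpen D) (hDc : ∀ z ∈ D, conj z ∈ D)
    (hp : ∀ z, p (conj z) = conj (p z)) (hF : IsStemOn F D)
    (h : ∀ i, ∃ k : ℂ → ℂ, DifferentiableOn ℂ k D ∧ ∀ z ∈ D, coord i (F z) = p z * k z) :
    ∃ G, IsStemOn G D ∧ ∀ z ∈ D, F z = p z • G z := by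
  choose k hk hk' using h
  refine ⟨fun z => (Quaternion.equivTuple ℂ).symm fun i => (k i z + conj (k i (conj z))) / 2,
    ⟨fun i => ?_, fun z hz => ext_coord fun i => ?_⟩, fun z hz => ext_coord fun i => ?_⟩
  · simp only [coord_equivTuple_symm]
    refine DifferentiableOn.div_const (DifferentiableOn.add (hk i) fun z hz => ?_) 2
    have := ((hk i).differentiableAt (hD.mem_nhds (hDc z hz))).conj_conj
    rw [Complex.conj_conj] at this
    exact this.differentiableWithinAt
  · rw [coord_cconj, coord_equivTuple_symm, coord_equivTuple_symm]
    simp [add_comm, Complex.conj_ofNat]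
  · have h2 := hk' i _ (hDc z hz)
    rw [hF.map_conj z hz, coord_cconj, hp] at h2
    have h3 := congrArg conj h2
    rw [map_mul, Complex.conj_conj, Complex.conj_conj] at h3
    rw [coord_smul, coord_equivTuple_symm]
    linear_combination (hk' i z hz + h3) / 2

/-- The polynomial `(z - x)² + y²`. -/
def quad (x y : ℝ) (z : ℂ) : ℂ := (z - x) ^ 2 + y ^ 2

lemma quad_conj (x y : ℝ) (z : ℂ) : quad x y (conj z) = conj (quad x y z) := by simp [quad]

lemma quad_eq (x y : ℝ) (z : ℂ) : quad x y z = (z - ⟨x, y⟩) * (z - conj ⟨x, y⟩) := by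
  have h : (⟨x, y⟩ : ℂ) = x + y * I := by rw [mul_comm]; apply Complex.ext <;> simp
  rw [h, quad]
  simp only [map_add, map_mul, Complex.conj_ofReal, Complex.conj_I]
  linear_combination y ^ 2 * Complex.I_sq

lemma quad_self (x y : ℝ) : quad x y ⟨x, y⟩ = 0 := by simp [quad_eq]

lemma quad_eq_zero {x y : ℝ} {z : ℂ} : quad x y z = 0 ↔ z = ⟨x, y⟩ ∨ z = conj ⟨x, y⟩ := by
  rw [quad_eq, mul_eq_zero, sub_eq_zero, sub_eq_zero]

@[fun_prop] lemma differentiable_quad (x y : ℝ) : Differentiable ℂ (quad x y) := by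
  unfold quad; fun_prop

@[fun_prop] lemma continuous_quad (x y : ℝ) : Continuous (quad x y) :=
  (differentiable_quad x y).continuous

lemma eventually_quad_ne_zero (x y : ℝ) (z₀ : ℂ) : ∀ᶠ z in 𝓝[≠] z₀, quad x y z ≠ 0 := by
  have h : ({⟨x, y⟩, conj ⟨x, y⟩} \ {z₀} : Set ℂ).Finite :=
    (Set.toFinite ({⟨x, y⟩, conj ⟨x, y⟩} : Set ℂ)).subset Set.sdiff_subset
  filter_upwards [nhdsWithin_le_nhds (h.isClosed.isOpen_compl.mem_nhds (by simp)),
    self_mem_nhdsWithin] with z hz hz' h0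
  exact hz ⟨quad_eq_zero.1 h0, hz'⟩

/-- By symmetry `F` also vanishes at the conjugate point. As `y ≠ 0` the two points are distinct, so
the two linear factors of `quad` can be divided out in turn. -/
lemma IsStemOn.exists_eq_quad_smul (hD : IsOpen D) (hDc : ∀ z ∈ D, conj z ∈ D)
    (hF : IsStemOn F D) (hy : y ≠ 0) (h0 : (⟨x, y⟩ : ℂ) ∈ D) (hF0 : F ⟨x, y⟩ = 0) :
    ∃ G, IsStemOn G D ∧ ∀ z ∈ D, F z = quad x y z • G z := by
  refine exists_stem_div hD hDc (quad_conj x y) hF fun i => ?_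
  have e0 : coord i (F ⟨x, y⟩) = 0 := by rw [hF0]; fin_cases i <;> simp
  have e1 : coord i (F (conj ⟨x, y⟩)) = 0 := by rw [hF.map_conj _ h0, coord_cconj, e0, map_zero]
  set f := fun z => coord i (F z)
  have hne : conj (⟨x, y⟩ : ℂ) - ⟨x, y⟩ ≠ 0 := by
    intro h
    have := congrArg Complex.im h
    simp at this
    exact hy (by linarith)
  have h1 : ∀ z, f z = (z - ⟨x, y⟩) * dslope f ⟨x, y⟩ z := fun z => by
    rw [← smul_eq_mul, sub_smul_dslope]; simp [f, e0]
  have h2 : dslope f ⟨x, y⟩ (conj ⟨x, y⟩) = 0 :=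
    (mul_eq_zero.1 ((h1 _).symm.trans e1)).resolve_left hne
  refine ⟨dslope (dslope f ⟨x, y⟩) (conj ⟨x, y⟩), ?_, fun z _ => ?_⟩
  · rw [Complex.differentiableOn_dslope (hD.mem_nhds (hDc _ h0)),
      Complex.differentiableOn_dslope (hD.mem_nhds h0)]
    exact hF.diff i
  · rw [quad_eq, mul_assoc]
    nth_rw 2 [← smul_eq_mul]
    rw [sub_smul_dslope, h2, sub_zero]
    exact h1 z

lemma IsStemOn.exists_eq_sub_smul (hD : IsOpen D) (hDc : ∀ z ∈ D, conj z ∈ D)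
    (hF : IsStemOn F D) (h0 : (x : ℂ) ∈ D) (hF0 : F x = 0) :
    ∃ G, IsStemOn G D ∧ ∀ z ∈ D, F z = (z - x) • G z := by
  refine exists_stem_div hD hDc (fun z => by simp) hF fun i => ?_
  have e0 : coord i (F x) = 0 := by rw [hF0]; fin_cases i <;> simp
  refine ⟨dslope (fun z => coord i (F z)) x, ?_, fun z _ => ?_⟩
  · rw [Complex.differentiableOn_dslope (hD.mem_nhds h0)]
    exact hF.diff i
  · rw [← smul_eq_mul, sub_smul_dslope]; simp [e0]

/-! ### Spheres and lists of roots -/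

lemma slice_mem_sphere {J : ℍ} (hJ : J ∈ imagUnits) : slice J ⟨x, y⟩ ∈ sphere x y := ⟨J, hJ, rfl⟩

lemma star_sub_emb (a : ℍ) (z : ℂ) : star ((z : ℍ[ℂ]) - emb a) = z - emb (star a) := by
  rw [star_sub, Quaternion.star_coe, emb_star]

lemma normSq_sub_emb {a : ℍ} (ha : a ∈ sphere x y) (z : ℂ) :
    Quaternion.normSq ((z : ℍ[ℂ]) - emb a) = quad x y z := by
  obtain ⟨J, hJ, rfl⟩ := ha
  have h := normSq_of_mem_imagUnits hJ
  have h0 := re_of_mem_imagUnits hJ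
  rw [Quaternion.normSq_def'] at h
  have h' : (J.imI : ℂ) ^ 2 + J.imJ ^ 2 + J.imK ^ 2 = 1 := by
    rw [h0] at h; exact_mod_cast (by linarith : J.imI ^ 2 + J.imJ ^ 2 + J.imK ^ 2 = 1)
  have e : ∀ r : ℝ, (⟨r, 0⟩ : ℂ) = r := fun r => rfl
  rw [Quaternion.normSq_def']
  simp [emb, quad, h0, e]
  linear_combination y ^ 2 * h'

lemma sub_emb_mul_sub_emb_star {a : ℍ} (ha : a ∈ sphere x y) (z : ℂ) :
    ((z : ℍ[ℂ]) - emb a) * (z - emb (star a)) = (quad x y z : ℂ) := by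
  rw [← star_sub_emb, Quaternion.self_mul_star, normSq_sub_emb ha]

lemma sub_emb_star_mul_sub_emb {a : ℍ} (ha : a ∈ sphere x y) (z : ℂ) :
    ((z : ℍ[ℂ]) - emb (star a)) * (z - emb a) = (quad x y z : ℂ) := by
  rw [← star_sub_emb, Quaternion.star_mul_self, normSq_sub_emb ha]

/-- Lists of points of `x + y 𝕊`, no two consecutive ones being conjugate. -/
def IsRootList (x y : ℝ) (l : List ℍ) : Prop :=
  (∀ a ∈ l, a ∈ sphere x y) ∧ l.IsChain fun a b => a ≠ star b

lemma IsRootList.tail {a : ℍ} {l : List ℍ} (h : IsRootList x y (a :: l)) : IsRootList x y l :=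
  ⟨fun b hb => h.1 b (List.mem_cons_of_mem a hb), h.2.tail⟩

lemma normSq_prodL {l : List ℍ} (hl : ∀ a ∈ l, a ∈ sphere x y) (z : ℂ) :
    Quaternion.normSq (prodL l z) = quad x y z ^ l.length := by
  induction l with
  | nil => simp
  | cons a l ih =>
    rw [prodL_cons, map_mul, normSq_sub_emb (hl a (by simp)), ih fun b hb => hl b (by simp [hb]),
      List.length_cons, pow_succ']

lemma isStemOn_prodL (l : List ℍ) : IsStemOn (prodL l) D := by
  induction l with
  | nil =>
    refine ⟨fun i => by simp, fun z _ => ?_⟩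
    rw [prodL_nil, prodL_nil]; ext <;> simp
  | cons a l ih =>
    have := (isStemOn_sub_emb (D := D) a).mul ih
    simpa only [← prodL_cons] using this

/-- Subtracting the two relations leaves `emb (a - b) * v = 0`, and a nonzero `emb (a - b)` is
invertible. -/
lemma eq_of_sub_emb_mul_eq_zero {a b : ℍ} {z : ℂ} {v : ℍ[ℂ]} (hv : v ≠ 0)
    (ha : ((z : ℍ[ℂ]) - emb a) * v = 0) (hb : ((z : ℍ[ℂ]) - emb b) * v = 0) : a = b := by
  by_contra hab
  refine hv (emb_mul_eq_zero (sub_ne_zero.2 hab) ?_)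
  have : emb (a - b) * v = (z - emb b) * v - (z - emb a) * v := by
    rw [emb_sub, ← sub_mul]; congr 1; abel
  rw [this, ha, hb, sub_zero]

lemma sub_emb_ne_zero (hy : y ≠ 0) (a : ℍ) : (((⟨x, y⟩ : ℂ) : ℍ[ℂ]) - emb a) ≠ 0 := by
  intro h
  have := congrArg (fun w => (imPart w).re) h
  simp [emb] at this
  exact hy this

lemma sub_emb_star_mul_prodL {a : ℍ} (ha : a ∈ sphere x y) (l : List ℍ) (w : ℍ[ℂ]) :
    (((⟨x, y⟩ : ℂ) : ℍ[ℂ]) - emb (star a)) * (prodL (a :: l) ⟨x, y⟩ * w) = 0 := by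
  rw [prodL_cons, ← mul_assoc, ← mul_assoc, sub_emb_star_mul_sub_emb ha, quad_self]
  simp

/-- If a factor `w - a` killed the product `v` of the remaining factors, nonzero by induction, then
`v` would be killed both by `w - a` and by `w - star b`, where `b` is its first root. That forces `a
= star b`, which the chain condition excludes. -/
lemma prodL_mul_ne_zero (hy : y ≠ 0) {l : List ℍ} (hl : IsRootList x y l) {w : ℍ[ℂ]}
    (hw : Quaternion.normSq w ≠ 0) : prodL l ⟨x, y⟩ * w ≠ 0 := by
  induction l with
  | nil => rw [prodL_nil, one_mul]; rintro rfl; simp at hw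
  | cons a l ih =>
    have ih' := ih hl.tail
    intro h
    rw [prodL_cons, mul_assoc] at h
    cases l with
    | nil =>
      rw [prodL_nil, one_mul] at h
      exact sub_emb_ne_zero hy a (mul_eq_zero_of_normSq_ne_zero hw h)
    | cons b l =>
      have hab : a ≠ star b := by have := hl.2; simp at this; exact this.1
      exact hab (eq_of_sub_emb_mul_eq_zero ih' h (sub_emb_star_mul_prodL (hl.1 b (by simp)) l w))

lemma exists_sub_emb_star_mul_eq_zero {w : ℍ[ℂ]} (hw : Quaternion.normSq w = 0) :
    ∃ a ∈ sphere x y, (((⟨x, y⟩ : ℂ) : ℍ[ℂ]) - emb (star a)) * w = 0 := by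
  obtain ⟨J, hJ, h⟩ := exists_ev_eq_zero hw
  -- For this choice of `a`, the factor `⟨x, y⟩ - star a` equals `y (J + ι)`, and `J + ι`
  -- annihilates the kernel of `ev J`.
  refine ⟨slice J ⟨x, y⟩, slice_mem_sphere hJ, ?_⟩
  have hr : rePart w = -(J * imPart w) := eq_neg_of_add_eq_zero_left h
  have h1 : rePart (((⟨x, y⟩ : ℂ) : ℍ[ℂ]) - emb (star (slice J ⟨x, y⟩))) = y • J := by
    rw [star_slice hJ]
    have h0 := re_of_mem_imagUnits hJ
    ext <;> simp [emb, slice, h0]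
  have h2 : imPart (((⟨x, y⟩ : ℂ) : ℍ[ℂ]) - emb (star (slice J ⟨x, y⟩))) = (y : ℍ) := by
    ext <;> simp [emb]
  apply ext_parts
  · rw [rePart_mul, h1, h2, hr, smul_mul_assoc, mul_neg, ← mul_assoc, mul_self_of_mem_imagUnits hJ,
      Quaternion.coe_mul_eq_smul]
    ext <;> simp
  · rw [imPart_mul, h1, h2, hr, smul_mul_assoc, Quaternion.coe_mul_eq_smul]
    ext <;> simp

end

/-! ### Local factorization of stem functions and its uniqueness -/

section

variable {D : Set ℂ} {F G : ℂ → ℍ[ℂ]} {x y : ℝ}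

/-! ### Factorization of stem functions -/

lemma eq_of_eventuallyEq_of_continuousAt {E : Type*} [TopologicalSpace E] [T2Space E]
    {A B : ℂ → E} {z₀ : ℂ} (hA : ContinuousAt A z₀) (hB : ContinuousAt B z₀)
    (h : ∀ᶠ z in 𝓝[≠] z₀, A z = B z) : A z₀ = B z₀ :=
  ((hA.eventuallyEq_nhds_iff_eventuallyEq_nhdsNE hB).1 h).eq_of_nhds

lemma IsStemOn.continuousAt_coord (hD : IsOpen D) (hF : IsStemOn F D) {z : ℂ} (hz : z ∈ D)
    (i : Fin 4) : ContinuousAt (fun z => coord i (F z)) z :=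
  ((hF.diff i).differentiableAt (hD.mem_nhds hz)).continuousAt

lemma IsStemOn.eq_of_eventuallyEq (hD : IsOpen D) (hF : IsStemOn F D) (hG : IsStemOn G D) {z : ℂ}
    (hz : z ∈ D) (h : ∀ᶠ w in 𝓝[≠] z, F w = G w) : F z = G z :=
  ext_coord fun i => eq_of_eventuallyEq_of_continuousAt (hF.continuousAt_coord hD hz i)
    (hG.continuousAt_coord hD hz i) (h.mono fun w hw => by rw [hw])

/-- The descent step: removing a factor that vanishes at `z₀` lowers the order of the norm by at
least one. -/
lemma analyticOrderAt_normSq_lt (hD : IsOpen D) {p : ℂ → ℂ} {z₀ : ℂ} (hz₀ : z₀ ∈ D)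
    (hp : AnalyticAt ℂ p z₀) (hp0 : p z₀ = 0) (hG : IsStemOn G D)
    (h : ∀ z ∈ D, Quaternion.normSq (F z) = p z * Quaternion.normSq (G z)) {N : ℕ}
    (hN : analyticOrderAt (fun z => Quaternion.normSq (F z)) z₀ < (N + 1 : ℕ)) :
    analyticOrderAt (fun z => Quaternion.normSq (G z)) z₀ < N := by
  have hGa : AnalyticAt ℂ (fun z => Quaternion.normSq (G z)) z₀ :=
    hG.differentiableOn_normSq.analyticAt (hD.mem_nhds hz₀)
  have e : (fun z => Quaternion.normSq (F z)) =ᶠ[𝓝 z₀] p * fun z => Quaternion.normSq (G z) := by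
    filter_upwards [hD.mem_nhds hz₀] with z hz using h z hz
  rw [analyticOrderAt_congr e, analyticOrderAt_mul hp hGa] at hN
  have h1 : 1 ≤ analyticOrderAt p z₀ := by
    rw [Order.one_le_iff_ne_zero, hp.analyticOrderAt_ne_zero]; exact hp0
  have h2 := (add_le_add_left h1 (analyticOrderAt (fun z => Quaternion.normSq (G z)) z₀)).trans_lt hN
  rw [Nat.cast_add, Nat.cast_one, add_comm] at h2
  exact lt_of_add_lt_add_right h2

/-- Factorization at a sphere `x + y 𝕊` that is not a point. -/
lemma exists_stem_factorization_of_ne (hD : IsOpen D) (hDc : ∀ z ∈ D, conj z ∈ D) (hy : y ≠ 0)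
    (h0 : (⟨x, y⟩ : ℂ) ∈ D) (N : ℕ) (F : ℂ → ℍ[ℂ]) (hF : IsStemOn F D)
    (hN : analyticOrderAt (fun z => Quaternion.normSq (F z)) ⟨x, y⟩ < N) :
    ∃ (m : ℕ) (l : List ℍ) (G : ℂ → ℍ[ℂ]), IsRootList x y l ∧ IsStemOn G D ∧
      Quaternion.normSq (G ⟨x, y⟩) ≠ 0 ∧ ∀ z ∈ D, F z = quad x y z ^ m • (prodL l z * G z) := by
  induction N generalizing F with
  | zero => simp at hN
  | succ N ih =>
    have hq : AnalyticAt ℂ (quad x y) ⟨x, y⟩ := (differentiable_quad x y).analyticAt _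
    by_cases hn : Quaternion.normSq (F ⟨x, y⟩) = 0
    swap
    · exact ⟨0, [], F, ⟨by simp, by simp⟩, hF, hn, fun z _ => by simp⟩
    by_cases hF0 : F ⟨x, y⟩ = 0
    · obtain ⟨G, hG, hFG⟩ := hF.exists_eq_quad_smul hD hDc hy h0 hF0
      obtain ⟨m, l, H, hl, hH, hH0, hGH⟩ := ih G hG (analyticOrderAt_normSq_lt hD h0
        (hq.pow 2) (by simp [quad_self]) hG (fun z hz => by
          rw [hFG z hz, ← Quaternion.coe_mul_eq_smul, map_mul, Quaternion.normSq_coe]; rfl) hN)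
      exact ⟨m + 1, l, H, hl, hH, hH0, fun z hz => by
        rw [hFG z hz, hGH z hz, smul_smul, pow_succ']⟩
    -- Here `F w` is a nonzero zero divisor: `(z - star a) F` vanishes at `w` and is divisible by
    -- `quad = (z - a)(z - star a)`.
    · obtain ⟨a, ha, hFa⟩ := exists_sub_emb_star_mul_eq_zero (x := x) (y := y) hn
      obtain ⟨G, hG, hFG⟩ := ((isStemOn_sub_emb (star a)).mul hF).exists_eq_quad_smul hD hDc hy h0 hFa
      -- Multiply by `z - a` and cancel `quad` off its zeros; continuity gives the remaining points.
      have key : ∀ z ∈ D, F z = (z - emb a) * G z := fun z hz => by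
        refine hF.eq_of_eventuallyEq hD ((isStemOn_sub_emb a).mul hG) hz ?_
        filter_upwards [eventually_quad_ne_zero x y z, nhdsWithin_le_nhds (hD.mem_nhds hz)]
          with w hw hwD
        have h1 : quad x y w • F w = quad x y w • ((w - emb a) * G w) := by
          rw [← Quaternion.coe_mul_eq_smul, ← sub_emb_mul_sub_emb_star ha, mul_assoc, hFG w hwD,
            mul_smul_comm]
        exact smul_right_injective _ hw h1
      obtain ⟨m, l, H, hl, hH, hH0, hGH⟩ := ih G hG (analyticOrderAt_normSq_lt hD h0
        hq (quad_self x y) hG (fun z hz => by rw [key z hz, map_mul, normSq_sub_emb ha]) hN)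
      have hF1 : ∀ z ∈ D, F z = quad x y z ^ m • (prodL (a :: l) z * H z) := fun z hz => by
        rw [key z hz, hGH z hz, prodL_cons, mul_smul_comm, mul_assoc]
      refine ⟨m, a :: l, H, ⟨by simpa [ha] using hl.1, ?_⟩, hH, hH0, hF1⟩
      cases l with
      | nil => simp
      | cons b l =>
        rw [List.isChain_cons_cons]
        refine ⟨?_, hl.2⟩
        -- Conjugate neighbours multiply to `quad`, which vanishes at `w` and contradicts `F w ≠ 0`.
        rintro rfl
        apply hF0
        rw [hF1 _ h0, prodL_cons, prodL_cons, ← mul_assoc, sub_emb_star_mul_sub_emb (hl.1 b (by simp)),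
          quad_self]
        simp

lemma mem_sphere_zero {a : ℍ} : a ∈ sphere x 0 ↔ a = x := by
  constructor
  · rintro ⟨J, -, rfl⟩; simp
  · rintro rfl; exact ⟨unitI, unitI_mem, by simp⟩

lemma IsRootList.eq_nil_or_of_zero {l : List ℍ} (hl : IsRootList x 0 l) :
    l = [] ∨ l = [(x : ℍ)] := by
  match l, hl with
  | [], _ => exact Or.inl rfl
  | [a], hl => exact Or.inr (by rw [mem_sphere_zero.1 (hl.1 a (by simp))])
  | a :: b :: l, hl =>
    have h := (List.isChain_cons_cons.1 hl.2).1
    rw [mem_sphere_zero.1 (hl.1 a (by simp)), mem_sphere_zero.1 (hl.1 b (by simp))] at h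
    simp at h

lemma sub_emb_coe (z : ℂ) (x : ℝ) : (z : ℍ[ℂ]) - emb x = ((z - x : ℂ) : ℍ[ℂ]) := by
  ext <;> simp [emb] <;> rfl

lemma quad_zero (x : ℝ) (z : ℂ) : quad x 0 z = (z - x) ^ 2 := by simp [quad]

/-- At a real point the symmetry puts `F x` in `ℍ`, where `normSq` is definite. Hence zero norm
means zero value, and only `z - x` has to be divided out. -/
lemma exists_stem_factorization_of_eq (hD : IsOpen D) (hDc : ∀ z ∈ D, conj z ∈ D)
    (h0 : (x : ℂ) ∈ D) (N : ℕ) (F : ℂ → ℍ[ℂ]) (hF : IsStemOn F D)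
    (hN : analyticOrderAt (fun z => Quaternion.normSq (F z)) x < N) :
    ∃ (m : ℕ) (G : ℂ → ℍ[ℂ]), IsStemOn G D ∧
      Quaternion.normSq (G x) ≠ 0 ∧ ∀ z ∈ D, F z = (z - x) ^ m • G z := by
  induction N generalizing F with
  | zero => simp at hN
  | succ N ih =>
    by_cases hn : Quaternion.normSq (F x) = 0
    swap
    · exact ⟨0, F, hF, hn, fun z _ => by simp⟩
    have hF0 : F x = 0 := by
      have h1 := hF.map_conj _ h0
      rw [Complex.conj_ofReal] at h1
      have h2 : F x = emb (rePart (F x)) :=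
        ext_parts rfl (imPart_eq_zero_of_eq_cconj h1)
      rw [h2, normSq_emb, Complex.ofReal_eq_zero, Quaternion.normSq_eq_zero] at hn
      rw [h2, hn]; ext <;> simp [emb] <;> rfl
    obtain ⟨G, hG, hFG⟩ := hF.exists_eq_sub_smul hD hDc h0 hF0
    obtain ⟨m, H, hH, hH0, hGH⟩ := ih G hG (analyticOrderAt_normSq_lt hD h0
      (p := fun z => (z - x) ^ 2) (by fun_prop) (by simp) hG (fun z hz => by
        rw [hFG z hz, ← Quaternion.coe_mul_eq_smul, map_mul, Quaternion.normSq_coe]) hN)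
    exact ⟨m + 1, H, hH, hH0, fun z hz => by
      rw [hFG z hz, hGH z hz, smul_smul, pow_succ']⟩

theorem exists_stem_factorization (hD : IsOpen D) (hDc : ∀ z ∈ D, conj z ∈ D)
    (h0 : (⟨x, y⟩ : ℂ) ∈ D) (hF : IsStemOn F D)
    (hF0 : ¬ ∀ᶠ z in 𝓝 (⟨x, y⟩ : ℂ), Quaternion.normSq (F z) = 0) :
    ∃ (m : ℕ) (l : List ℍ) (G : ℂ → ℍ[ℂ]), IsRootList x y l ∧ IsStemOn G D ∧
      Quaternion.normSq (G ⟨x, y⟩) ≠ 0 ∧ ∀ z ∈ D, F z = quad x y z ^ m • (prodL l z * G z) := by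
  rw [← analyticOrderAt_eq_top] at hF0
  obtain ⟨N, hN⟩ := ENat.ne_top_iff_exists.1 hF0
  have hN' : analyticOrderAt (fun z => Quaternion.normSq (F z)) ⟨x, y⟩ < (N + 1 : ℕ) := by
    rw [← hN]; exact_mod_cast Nat.lt_succ_self N
  by_cases hy : y = 0
  · subst hy
    obtain ⟨k, G, hG, hG0, hFG⟩ := exists_stem_factorization_of_eq hD hDc h0 _ F hF hN'
    -- As `quad x 0 z = (z - x)²`, an odd exponent leaves one factor `z - x`, recorded as the single
    -- root `x`.
    rcases Nat.even_or_odd' k with ⟨m, rfl | rfl⟩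
    · refine ⟨m, [], G, ⟨by simp, by simp⟩, hG, hG0, fun z hz => ?_⟩
      rw [hFG z hz, prodL_nil, one_mul, quad_zero, ← pow_mul]
    · refine ⟨m, [(x : ℍ)], G, ⟨by simp [mem_sphere_zero], by simp⟩, hG, hG0, fun z hz => ?_⟩
      rw [hFG z hz, prodL_cons, prodL_nil, mul_one, quad_zero, ← pow_mul, sub_emb_coe,
        Quaternion.coe_mul_eq_smul, smul_smul, pow_succ]
  · exact exists_stem_factorization_of_ne hD hDc hy h0 _ F hF hN'

/-! ### Uniqueness of the factorization -/

/-- If `m < k`, cancelling `p ^ m` gives `A = p ^ (k - m) • B` near `z₀`, so `A` would vanish at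
`z₀`. -/
lemma zpow_le_of_zpow_smul_eq {E : Type*} [NormedAddCommGroup E] [NormedSpace ℂ E] {p : ℂ → ℂ}
    {A B : ℂ → E} {z₀ : ℂ} {m k : ℤ} (hp : ContinuousAt p z₀) (hp0 : p z₀ = 0)
    (hp1 : ∀ᶠ z in 𝓝[≠] z₀, p z ≠ 0) (hA : ContinuousAt A z₀) (hB : ContinuousAt B z₀)
    (hA0 : A z₀ ≠ 0) (h : ∀ᶠ z in 𝓝[≠] z₀, p z ^ m • A z = p z ^ k • B z) : k ≤ m := by
  by_contra! hmk
  obtain ⟨n, hn⟩ := Int.eq_ofNat_of_zero_le (sub_nonneg.2 hmk.le)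
  have hn0 : n ≠ 0 := by rintro rfl; simp at hn; omega
  apply hA0
  have h1 : A z₀ = p z₀ ^ n • B z₀ := by
    refine eq_of_eventuallyEq_of_continuousAt (B := fun z => p z ^ n • B z) hA
      ((hp.pow n).smul hB) ?_
    filter_upwards [h, hp1] with z hz hpz
    have : p z ^ m • A z = p z ^ m • (p z ^ n • B z) := by
      rw [hz, smul_smul, ← zpow_natCast, ← zpow_add₀ hpz]; congr 2; omega
    exact smul_right_injective _ (zpow_ne_zero m hpz) this
  rw [h1, hp0, zero_pow hn0, zero_smul]

lemma zpow_smul_eq_unique {E : Type*} [NormedAddCommGroup E] [NormedSpace ℂ E] {p : ℂ → ℂ}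
    {A B : ℂ → E} {z₀ : ℂ} {m k : ℤ} (hp : ContinuousAt p z₀) (hp0 : p z₀ = 0)
    (hp1 : ∀ᶠ z in 𝓝[≠] z₀, p z ≠ 0) (hA : ContinuousAt A z₀) (hB : ContinuousAt B z₀)
    (hA0 : A z₀ ≠ 0) (hB0 : B z₀ ≠ 0)
    (h : ∀ᶠ z in 𝓝[≠] z₀, p z ^ m • A z = p z ^ k • B z) : m = k ∧ A z₀ = B z₀ := by
  have hmk : m = k := le_antisymm
    (zpow_le_of_zpow_smul_eq hp hp0 hp1 hB hA hB0 (h.mono fun _ hz => hz.symm))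
    (zpow_le_of_zpow_smul_eq hp hp0 hp1 hA hB hA0 h)
  subst hmk
  refine ⟨rfl, eq_of_eventuallyEq_of_continuousAt hA hB ?_⟩
  filter_upwards [h, hp1] with z hz hpz using smul_right_injective _ (zpow_ne_zero m hpz) hz

lemma stem_zpow_smul_eq_unique {p : ℂ → ℂ} {A B : ℂ → ℍ[ℂ]} {z₀ : ℂ} {m k : ℤ}
    (hp : ContinuousAt p z₀) (hp0 : p z₀ = 0) (hp1 : ∀ᶠ z in 𝓝[≠] z₀, p z ≠ 0)
    (hA : ∀ i, ContinuousAt (fun z => coord i (A z)) z₀)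
    (hB : ∀ i, ContinuousAt (fun z => coord i (B z)) z₀)
    (hA0 : A z₀ ≠ 0) (hB0 : B z₀ ≠ 0)
    (h : ∀ᶠ z in 𝓝[≠] z₀, p z ^ m • A z = p z ^ k • B z) : m = k ∧ A z₀ = B z₀ := by
  have hne : ∀ {w : ℍ[ℂ]}, w ≠ 0 → (fun i => coord i w) ≠ 0 := fun hw h =>
    hw (ext_coord fun i => by rw [congrFun h i]; fin_cases i <;> simp)
  have := zpow_smul_eq_unique (m := m) (k := k) (A := fun z i => coord i (A z)) (B := fun z i => coord i (B z))
    hp hp0 hp1 (continuousAt_pi.2 hA) (continuousAt_pi.2 hB) (hne hA0) (hne hB0)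
    (h.mono fun z hz => by
      ext i
      simp only [Pi.smul_apply, smul_eq_mul, ← coord_smul, hz])
  exact ⟨this.1, ext_coord fun i => congrFun this.2 i⟩

lemma continuousAt_coord_prodL_mul {l : List ℍ} {z₀ : ℂ}
    (hG : ∀ i, ContinuousAt (fun z => coord i (G z)) z₀) (i : Fin 4) :
    ContinuousAt (fun z => coord i (prodL l z * G z)) z₀ :=
  coord_mul_induction (Q := fun f => ContinuousAt f z₀) (fun _ _ h h' => h.add h')
    (fun _ _ h h' => h.sub h') (fun _ _ h h' => h.mul h')
    (fun i => (isStemOn_prodL l).continuousAt_coord isOpen_univ (Set.mem_univ z₀) i) hG i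

lemma continuousAt_normSq {z₀ : ℂ} (hG : ∀ i, ContinuousAt (fun z => coord i (G z)) z₀) :
    ContinuousAt (fun z => Quaternion.normSq (G z)) z₀ := by
  simp only [Quaternion.normSq_def']
  exact ((((hG 0).pow 2).add ((hG 1).pow 2)).add ((hG 2).pow 2)).add ((hG 3).pow 2)

theorem stem_factorization_unique {z₀ : ℂ} (hz₀ : z₀ = ⟨x, y⟩) {m k : ℤ} {l l' : List ℍ}
    {G H : ℂ → ℍ[ℂ]}
    (hl : IsRootList x y l) (hl' : IsRootList x y l')
    (hG : ∀ i, ContinuousAt (fun z => coord i (G z)) z₀)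
    (hH : ∀ i, ContinuousAt (fun z => coord i (H z)) z₀)
    (hG0 : Quaternion.normSq (G z₀) ≠ 0) (hH0 : Quaternion.normSq (H z₀) ≠ 0)
    (h : ∀ᶠ z in 𝓝[≠] z₀,
      quad x y z ^ m • (prodL l z * G z) = quad x y z ^ k • (prodL l' z * H z)) :
    m = k ∧ l.length = l'.length ∧ l.head? = l'.head? := by
  have hq : ContinuousAt (quad x y) z₀ := (continuous_quad x y).continuousAt
  have hq0 : quad x y z₀ = 0 := by rw [hz₀, quad_self]
  have hq1 := eventually_quad_ne_zero x y z₀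
  by_cases hy : y = 0
  · subst hy
    replace hz₀ : z₀ = x := hz₀
    -- When `y = 0` a root list has length at most one, so the exponent `2 m + length` determines
    -- `m` and the length by parity.
    have key : ∀ {l : List ℍ}, IsRootList x 0 l → ∀ (m : ℤ) {z : ℂ}, z ≠ x → ∀ w : ℍ[ℂ],
        quad x 0 z ^ m • (prodL l z * w) = (z - x) ^ (2 * m + l.length) • w := by
      intro l hl m z hz w
      have e : quad x 0 z ^ m = (z - x) ^ (2 * m) := by
        rw [quad_zero, zpow_mul]; norm_cast
      rw [e]
      rcases hl.eq_nil_or_of_zero with rfl | rfl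
      · simp
      · rw [prodL_cons, prodL_nil, mul_one, sub_emb_coe, Quaternion.coe_mul_eq_smul, smul_smul,
          List.length_singleton, zpow_add₀ (sub_ne_zero.2 hz)]
        simp
    have h1 := (stem_zpow_smul_eq_unique (p := fun z => z - x) (m := 2 * m + l.length)
      (k := 2 * k + l'.length) (by fun_prop) (by simp [hz₀])
      (by filter_upwards [self_mem_nhdsWithin] with z hz using sub_ne_zero.2 (hz₀ ▸ hz)) hG hH
      (by rintro h; simp [h] at hG0) (by rintro h; simp [h] at hH0) (by
        filter_upwards [h, self_mem_nhdsWithin] with z hz hz'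
        rwa [key hl m (hz₀ ▸ hz'), key hl' k (hz₀ ▸ hz')] at hz)).1
    rcases hl.eq_nil_or_of_zero with rfl | rfl <;> rcases hl'.eq_nil_or_of_zero with rfl | rfl <;>
      simp at h1 ⊢ <;> omega
  · have hA0 := prodL_mul_ne_zero hy hl (hz₀ ▸ hG0)
    have hB0 := prodL_mul_ne_zero hy hl' (hz₀ ▸ hH0)
    rw [← hz₀] at hA0 hB0
    obtain ⟨hmk, hAB⟩ := stem_zpow_smul_eq_unique hq hq0 hq1 (continuousAt_coord_prodL_mul hG)
      (continuousAt_coord_prodL_mul hH) hA0 hB0 h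
    subst hmk
    -- Taking norms turns each product of linear factors into `quad ^ length` times a unit at `z₀`,
    -- so the lengths are comparable exponents.
    have hlen : (l.length : ℤ) = l'.length := by
      refine (zpow_smul_eq_unique hq hq0 hq1 (continuousAt_normSq hG) (continuousAt_normSq hH)
        hG0 hH0 ?_).1
      filter_upwards [h, hq1] with z hz hqz
      have := congrArg Quaternion.normSq (smul_right_injective _ (zpow_ne_zero m hqz) hz)
      rw [map_mul, map_mul, normSq_prodL hl.1, normSq_prodL hl'.1] at this
      simpa using this
    refine ⟨rfl, by exact_mod_cast hlen, ?_⟩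
    cases l with
    | nil => cases l' with
      | nil => rfl
      | cons => simp at hlen; omega
    | cons a l => cases l' with
      | nil => simp at hlen; omega
      | cons b l' =>
        -- Both first roots give a left annihilator of the same nonzero value at `z₀`.
        have h1 := sub_emb_star_mul_prodL (hl.1 a (by simp)) l (G ⟨x, y⟩)
        have h2 := sub_emb_star_mul_prodL (hl'.1 b (by simp)) l' (H ⟨x, y⟩)
        rw [← hz₀] at h1 h2
        rw [← hAB] at h2
        have := eq_of_sub_emb_mul_eq_zero hA0 h1 h2
        rw [List.head?_cons, List.head?_cons, star_injective this]

end

/-! ### Correspondence between slice regular functions and holomorphic stem functions -/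

section

variable {D : Set ℂ} {F G : ℂ → ℍ[ℂ]} {x y : ℝ} {Ω : Set ℍ} {f g : ℍ → ℍ} {J K : ℍ}

/-! ### Symmetric sets -/

lemma IsSymmetric.slice_mem (h : IsSymmetric Ω) (hJ : J ∈ imagUnits) (hK : K ∈ imagUnits) {z : ℂ}
    (hz : slice J z ∈ Ω) : slice K z ∈ Ω :=
  h z.re z.im J hJ hz (slice_mem_sphere hK)

lemma IsSymmetric.sliceSet_eq (h : IsSymmetric Ω) (hJ : J ∈ imagUnits) (hK : K ∈ imagUnits) :
    sliceSet J Ω = sliceSet K Ω :=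
  Set.ext fun _ => ⟨h.slice_mem hJ hK, h.slice_mem hK hJ⟩

lemma IsSymmetric.conj_mem (h : IsSymmetric Ω) (hJ : J ∈ imagUnits) {z : ℂ}
    (hz : z ∈ sliceSet J Ω) : conj z ∈ sliceSet J Ω := by
  change slice J (conj z) ∈ Ω
  rw [← slice_neg]
  exact h.slice_mem hJ (neg_mem_imagUnits hJ) hz

lemma IsSymmetric.coordOf_mem (h : IsSymmetric Ω) (hJ : J ∈ imagUnits) {q : ℍ} :
    coordOf q ∈ sliceSet J Ω ↔ q ∈ Ω := by
  obtain ⟨K, hK, h2⟩ := exists_slice q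
  rw [h.sliceSet_eq hJ hK]
  change slice K (coordOf q) ∈ Ω ↔ q ∈ Ω
  rw [h2]

/-! ### Regular functions have holomorphic stem functions -/

/-- The contribution of a value of `f` on the line `ℝ + J ℝ` to the stem function. -/
def halfStem (J : ℍ) (i : Fin 4) : ℍ →ₗ[ℝ] ℂ where
  toFun q := coord i (cplx ((2⁻¹ : ℝ) • q) (-((2⁻¹ : ℝ) • (J * q))))
  map_add' p q := by fin_cases i <;> apply Complex.ext <;> simp <;> ring
  map_smul' r q := by fin_cases i <;> apply Complex.ext <;> simp <;> ring

lemma halfStem_apply (J : ℍ) (i : Fin 4) (q : ℍ) :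
    halfStem J i q = coord i (cplx ((2⁻¹ : ℝ) • q) (-((2⁻¹ : ℝ) • (J * q)))) := rfl

/-- Left multiplication by `J` becomes multiplication by `i`, so the equation `dbar = 0` becomes the
Cauchy–Riemann equation. -/
lemma halfStem_mul (hJ : J ∈ imagUnits) (i : Fin 4) (q : ℍ) :
    halfStem J i (J * q) = I * halfStem J i q := by
  rw [halfStem_apply, halfStem_apply, ← mul_assoc, mul_self_of_mem_imagUnits hJ]
  fin_cases i <;> apply Complex.ext <;> simp

/-- The value at `conj z` on the line of `J` is the value at `z` on the line of `-J`. With this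
reparametrization both summands are holomorphic in `z`, not antiholomorphic. -/
lemma coord_stemOf (f : ℍ → ℍ) (J : ℍ) (i : Fin 4) (z : ℂ) :
    coord i (stemOf f J z) =
      halfStem J i (f (slice J z)) + halfStem (-J) i (f (slice (-J) z)) := by
  rw [halfStem_apply, halfStem_apply, stemOf, slice_neg]
  fin_cases i <;> apply Complex.ext <;> simp <;> ring

lemma IsRegularOn.differentiableAt_halfStem (hf : IsRegularOn f Ω) (hJ : J ∈ imagUnits)
    (hΩ : IsOpen (sliceSet J Ω)) (i : Fin 4) {z : ℂ} (hz : z ∈ sliceSet J Ω) :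
    DifferentiableAt ℂ (fun w => halfStem J i (f (slice J w))) z := by
  set φ : ℂ → ℍ := fun w => f (slice J w)
  have hφ : DifferentiableAt ℝ φ z :=
    (((hf J hJ).1.contDiffAt (hΩ.mem_nhds hz)).differentiableAt (by norm_num))
  have h0 : fderiv ℝ φ z 1 + J * fderiv ℝ φ z I = 0 := by
    have := (hf J hJ).2 z hz
    rw [dbar, two_inv_mul] at this
    exact (smul_eq_zero.1 this).resolve_left (by norm_num)
  have h1 : fderiv ℝ φ z I = J * fderiv ℝ φ z 1 := by
    rw [eq_neg_of_add_eq_zero_left h0, mul_neg, ← mul_assoc, mul_self_of_mem_imagUnits hJ]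
    noncomm_ring
  have h2 : HasFDerivAt (fun w => halfStem J i (φ w))
      ((halfStem J i).toContinuousLinearMap.comp (fderiv ℝ φ z)) z :=
    (halfStem J i).toContinuousLinearMap.hasFDerivAt.comp z hφ.hasFDerivAt
  refine differentiableAt_complex_iff_differentiableAt_real.2 ⟨h2.differentiableAt, ?_⟩
  rw [h2.fderiv, ContinuousLinearMap.comp_apply, ContinuousLinearMap.comp_apply, h1]
  exact halfStem_mul hJ i _

lemma IsRegularOn.isStemOn_stemOf (hf : IsRegularOn f Ω) (hΩ : IsSymmetricSliceDomain Ω)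
    (hJ : J ∈ imagUnits) : IsStemOn (stemOf f J) (sliceSet J Ω) where
  diff i z hz := by
    simp only [coord_stemOf]
    have hJ' := neg_mem_imagUnits hJ
    refine (DifferentiableAt.add (hf.differentiableAt_halfStem hJ (hΩ.slice_isOpen J hJ) i hz)
      (hf.differentiableAt_halfStem hJ' (hΩ.slice_isOpen _ hJ') i ?_)).differentiableWithinAt
    rwa [hΩ.symmetric.sliceSet_eq hJ' hJ]
  map_conj z _ := stemOf_conj f J z

lemma frequently_im_eq_zero (r : ℝ) : ∃ᶠ z : ℂ in 𝓝[≠] (r : ℂ), z.im = 0 := by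
  have h : Tendsto (fun t : ℝ => (t : ℂ)) (𝓝[≠] r) (𝓝[≠] (r : ℂ)) :=
    tendsto_nhdsWithin_of_tendsto_nhds_of_eventually_within _
      ((Complex.continuous_ofReal.tendsto r).mono_left nhdsWithin_le_nhds)
      (by filter_upwards [self_mem_nhdsWithin] with t ht using fun h => ht (Complex.ofReal_injective h))
  exact h.frequently (Eventually.frequently (Eventually.of_forall fun t => Complex.ofReal_im t))

lemma IsStemOn.eqOn_of_eq_real (hD : IsOpen D) (hDc : IsPreconnected D) {r : ℝ}
    (hr : (r : ℂ) ∈ D) (hF : IsStemOn F D) (hG : IsStemOn G D)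
    (h : ∀ t : ℝ, (t : ℂ) ∈ D → F t = G t) : ∀ z ∈ D, F z = G z := fun z hz => by
  refine ext_coord fun i => ?_
  refine ((hF.diff i).analyticOnNhd hD).eqOn_of_preconnected_of_frequently_eq
    ((hG.diff i).analyticOnNhd hD) hDc hr ?_ hz
  refine ((frequently_im_eq_zero r).and_eventually
    (nhdsWithin_le_nhds (hD.mem_nhds hr))).mono fun w hw => ?_
  have e : w = (w.re : ℂ) := Complex.ext rfl hw.1
  rw [e] at hw ⊢
  rw [h _ hw.2]

lemma stemOf_real (f : ℍ → ℍ) (J : ℍ) (t : ℝ) : stemOf f J t = emb (f t) := by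
  rw [stemOf, Complex.conj_ofReal, slice_ofReal, sub_self, mul_zero, smul_zero, neg_zero, emb]
  congr 1
  ext <;> simp <;> ring

lemma IsSymmetricSliceDomain.exists_real_mem (hΩ : IsSymmetricSliceDomain Ω) (J : ℍ) :
    ∃ r : ℝ, (r : ℂ) ∈ sliceSet J Ω := by
  obtain ⟨r, hr⟩ := hΩ.meets_real
  exact ⟨r, by rwa [sliceSet, Set.mem_ofPred_eq, slice_ofReal]⟩

/-- The representation formula: at real points every stem function equals `emb (f t)` whatever the
unit, and the identity theorem spreads the equality over the slice. -/
lemma IsRegularOn.stemOf_eq_stemOf (hf : IsRegularOn f Ω) (hΩ : IsSymmetricSliceDomain Ω)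
    (hJ : J ∈ imagUnits) (hK : K ∈ imagUnits) {z : ℂ} (hz : z ∈ sliceSet J Ω) :
    stemOf f K z = stemOf f J z := by
  obtain ⟨r, hr⟩ := hΩ.exists_real_mem J
  refine IsStemOn.eqOn_of_eq_real (hΩ.slice_isOpen J hJ) (hΩ.slice_isConnected J hJ).isPreconnected
    hr ?_ (hf.isStemOn_stemOf hΩ hJ) (fun t _ => by rw [stemOf_real, stemOf_real]) z hz
  rw [hΩ.symmetric.sliceSet_eq hJ hK]
  exact hf.isStemOn_stemOf hΩ hK

/-! ### Holomorphic stem functions induce regular functions -/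

/-- The function on `ℍ` induced by a stem function. -/
def induced (F : ℂ → ℍ[ℂ]) (q : ℍ) : ℍ := ev (imUnit q) (F (coordOf q))

lemma induced_slice (hJ : J ∈ imagUnits) {z : ℂ} (hF : F (conj z) = cconj (F z)) :
    induced F (slice J z) = ev J (F z) := by
  rw [induced, imUnit_slice hJ, coordOf_slice hJ]
  rcases lt_trichotomy z.im 0 with h | h | h
  · rw [sign_neg h, abs_of_neg h]
    change ev _ (F (conj z)) = _
    rw [hF, ev_cconj]; simp
  · have hz : conj z = z := Complex.conj_eq_iff_im.2 h
    have h0 : imPart (F z) = 0 := imPart_eq_zero_of_eq_cconj (hz ▸ hF :)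
    have e : (⟨z.re, |z.im|⟩ : ℂ) = z := Complex.ext rfl (by simp [h])
    rw [e, ev, ev, h0, mul_zero, mul_zero]
  · rw [sign_pos h, abs_of_pos h]
    simp

/-- `slice J` as a continuous real linear map. -/
def sliceCLM (J : ℍ) : ℂ →L[ℝ] ℍ :=
  Complex.reCLM.smulRight (1 : ℍ) + Complex.imCLM.smulRight J

lemma sliceCLM_apply (J : ℍ) (z : ℂ) : sliceCLM J z = slice J z := by
  simp only [sliceCLM, slice, add_apply, ContinuousLinearMap.smulRight_apply,
    Complex.reCLM_apply, Complex.imCLM_apply, Quaternion.coe_mul_eq_smul]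
  congr 1
  ext <;> simp

/-- The standard basis of the quaternions. -/
def stdBasis (i : Fin 4) : ℍ := (Quaternion.equivTuple ℝ).symm (Pi.single i 1)

@[simp] lemma stdBasis_re (i : Fin 4) : (stdBasis i).re = Pi.single (M := fun _ => ℝ) i 1 0 := rfl
@[simp] lemma stdBasis_imI (i : Fin 4) : (stdBasis i).imI = Pi.single (M := fun _ => ℝ) i 1 1 := rfl
@[simp] lemma stdBasis_imJ (i : Fin 4) : (stdBasis i).imJ = Pi.single (M := fun _ => ℝ) i 1 2 := rfl
@[simp] lemma stdBasis_imK (i : Fin 4) : (stdBasis i).imK = Pi.single (M := fun _ => ℝ) i 1 3 := rfl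

lemma ev_eq_sum (J : ℍ) (w : ℍ[ℂ]) : ev J w = ∑ i, slice J (coord i w) * stdBasis i := by
  simp only [ev, Fin.sum_univ_four, slice]
  ext <;> simp <;> ring

/-- On each line `g` is a sum of terms `slice J (h z) * e` with `h` holomorphic and `e` constant.
Each solves the equation because `slice J` is multiplicative and sends `i` to `J`. -/
lemma isRegularOn_of_stem (hΩ : ∀ J ∈ imagUnits, IsOpen (sliceSet J Ω))
    (hF : ∀ J ∈ imagUnits, IsStemOn F (sliceSet J Ω))
    (h : ∀ J ∈ imagUnits, ∀ z ∈ sliceSet J Ω, g (slice J z) = ev J (F z)) :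
    IsRegularOn g Ω := by
  intro J hJ
  have hD := hΩ J hJ
  have hg : ∀ z ∈ sliceSet J Ω, g (slice J z) = ∑ i, sliceCLM J (coord i (F z)) * stdBasis i := by
    intro z hz
    rw [h J hJ z hz, ev_eq_sum]
    simp only [sliceCLM_apply]
  refine ⟨ContDiffOn.congr (ContDiffOn.sum fun i _ => ?_) hg, fun z hz => ?_⟩
  · exact ((sliceCLM J).contDiff.comp_contDiffOn
      ((((hF J hJ).diff i).contDiffOn hD).restrict_scalars ℝ)).mul contDiffOn_const
  · have hd : ∀ i, HasFDerivAt (fun w => sliceCLM J (coord i (F w)) * stdBasis i) _ z := fun i =>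
      (((sliceCLM J).hasFDerivAt.comp z
        ((((hF J hJ).diff i).differentiableAt (hD.mem_nhds hz)).hasDerivAt.hasFDerivAt.restrictScalars
          ℝ)).mul_const' (stdBasis i))
    have hs := HasFDerivAt.fun_sum (u := Finset.univ) fun i _ => hd i
    have e : (fun w => g (slice J w)) =ᶠ[𝓝 z]
        fun w => ∑ i, sliceCLM J (coord i (F w)) * stdBasis i := by
      filter_upwards [hD.mem_nhds hz] with w hw using hg w hw
    have hI : slice J I = J := by simp [slice]
    rw [dbar, e.fderiv_eq, hs.fderiv]
    simp only [sum_apply, Finset.mul_sum, ← Finset.sum_add_distrib]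
    refine Finset.sum_eq_zero fun i _ => ?_
    simp [sliceCLM_apply, slice_mul hJ, hI]
    refine Or.inr ?_
    have h1 := mul_comm_slice (J := J) (deriv (fun z => coord i (F z)) z)
    have h2 := mul_self_of_mem_imagUnits hJ
    simp only [← mul_assoc, h1, mul_assoc _ J J, h2]
    noncomm_ring

end

/-! ### Poles of functions and meromorphy of stem functions -/

section

variable {D : Set ℂ} {F G : ℂ → ℍ[ℂ]} {x y : ℝ} {Ω Ω' : Set ℍ} {f g : ℍ → ℍ} {J K : ℍ}

/-! ### Powers of `q - p` on the line through `p` -/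

lemma commute_slice (J : ℍ) (z : ℂ) : Commute J (slice J z) := mul_comm_slice z

lemma ev_sub_emb_mul (hJ : J ∈ imagUnits) (z w : ℂ) (v : ℍ[ℂ]) :
    ev J (((z : ℍ[ℂ]) - emb (slice J w)) * v) = slice J (z - w) * ev J v := by
  have h1 : rePart ((z : ℍ[ℂ]) - emb (slice J w)) = (z.re : ℍ) - slice J w := by
    ext <;> simp [emb]
  have h2 : imPart ((z : ℍ[ℂ]) - emb (slice J w)) = (z.im : ℍ) := by
    ext <;> simp [emb]
  rw [ev_mul_of_commute hJ, ev_sub, ev_coe hJ, ev_emb, slice_sub]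
  · rw [h1]
    exact (Quaternion.coe_commute _ _).symm.sub_right (commute_slice J w)
  · rw [h2]
    exact (Quaternion.coe_commute _ _).symm

lemma ev_sub_emb_pow_mul (hJ : J ∈ imagUnits) (z w : ℂ) (n : ℕ) (v : ℍ[ℂ]) :
    ev J (((z : ℍ[ℂ]) - emb (slice J w)) ^ n * v) = slice J ((z - w) ^ n) * ev J v := by
  induction n with
  | zero => simp [slice]
  | succ n ih => rw [pow_succ', mul_assoc, ev_sub_emb_mul hJ, ih, pow_succ', slice_mul hJ, mul_assoc]

lemma ev_one (J : ℍ) : ev J 1 = 1 := by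
  have h1 : rePart (1 : ℍ[ℂ]) = 1 := by ext <;> simp
  have h2 : imPart (1 : ℍ[ℂ]) = 0 := by ext <;> simp
  rw [ev, h1, h2]; simp

lemma ev_sub_emb_pow (hJ : J ∈ imagUnits) (z w : ℂ) (n : ℕ) :
    ev J (((z : ℍ[ℂ]) - emb (slice J w)) ^ n) = slice J ((z - w) ^ n) := by
  have := ev_sub_emb_pow_mul hJ z w n 1
  rwa [mul_one, ev_one, mul_one] at this

lemma stemOf_starPow (p : ℍ) (hJ : J ∈ imagUnits) (z : ℂ) (n : ℕ) :
    stemOf (starPow (fun q => q - p) n) J z = ((z : ℍ[ℂ]) - emb p) ^ n := by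
  induction n with
  | zero =>
    rw [pow_zero]
    refine stemOf_eq hJ ?_ ?_
    · rw [ev_one]; rfl
    · rw [ev_cconj, ev_one]; rfl
  | succ n ih => rw [starPow, stemOf_starMul _ _ hJ, ih, stemOf_sub_const p hJ, pow_succ']

/-- On the line through `p` the factor `q - p` commutes with `J`, so evaluation is multiplicative
and `*`-powers are ordinary powers. For negative exponents the symmetrization contributes an extra
power of `z - conj w`, cancelled by the conjugate; hence the excluded point. -/
lemma starZPow_slice (hJ : J ∈ imagUnits) {z w : ℂ} (hzw : z ≠ conj w) (n : ℤ) :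
    starZPow (slice J w) n (slice J z) = slice J ((z - w) ^ n) := by
  cases n with
  | ofNat n =>
    rw [starZPow, ← ev_stemOf (starPow _ n) hJ, stemOf_starPow _ hJ, ev_sub_emb_pow hJ, Int.ofNat_eq_natCast,
      zpow_natCast]
  | negSucc n =>
    have h1 : ev J (star (((z : ℍ[ℂ]) - emb (slice J w)) ^ (n + 1))) =
        slice J ((z - conj w) ^ (n + 1)) := by
      have h := star_pow ((z : ℍ[ℂ]) - emb (slice J w)) (n + 1)
      rw [star_sub_emb, star_slice hJ] at h
      exact (congrArg (ev J) h).trans (ev_sub_emb_pow hJ _ _ _)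
    rw [starZPow, regRecip, symmetrization, starMul_slice _ _ hJ, stemOf_regConj _ hJ,
      regConj_slice _ hJ, stemOf_starPow _ hJ, ev_sub_emb_pow_mul hJ, h1, ← slice_mul hJ]
    simp only [← sliceHom_apply hJ]
    rw [← map_inv₀, ← map_mul, zpow_negSucc, mul_inv, mul_assoc,
      inv_mul_cancel₀ (pow_ne_zero _ (sub_ne_zero.2 hzw)), mul_one]

/-! ### Distances on a complex line -/

lemma sameLine_slice (hJ : J ∈ imagUnits) (z w : ℂ) : SameLine (slice J z) (slice J w) :=
  ⟨J, hJ, ⟨z, rfl⟩, ⟨w, rfl⟩⟩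

lemma norm_slice_sub_slice (hJ : J ∈ imagUnits) (z w : ℂ) :
    ‖slice J z - slice J w‖ = ‖z - w‖ := by
  rw [← slice_sub, norm_slice hJ]

lemma slice_mem_sigmaShell (hJ : J ∈ imagUnits) {z w : ℂ} {R : ℝ} :
    slice J z ∈ sigmaShell (slice J w) 0 R ↔ z ≠ w ∧ ‖z - w‖ < R := by
  rw [sigmaShell, Set.mem_ofPred_eq, tau, sigma, if_pos (sameLine_slice hJ z w),
    if_pos (sameLine_slice hJ z w), norm_slice_sub_slice hJ, norm_pos_iff, sub_ne_zero]

/-! ### Poles of `f` are poles of the stem function -/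

/-- The Laurent series restricted to the line is an ordinary one. After multiplication by `(z - w) ^
m` only exponents `≥ 0` survive, so the terms are dominated by their absolute values at radius `R /
2`. -/
lemma IsPole.exists_bound (hJ : J ∈ imagUnits) {w : ℂ} (h : IsPole f Ω (slice J w))
    (hΩ : IsSymmetric Ω) (hw : slice J w ∉ Ω) :
    ∃ R > 0, ∃ (M : ℕ) (C : ℝ), ∀ z, z ≠ w → ‖z - w‖ < R →
      z ∈ sliceSet J Ω ∧ ‖z - w‖ ^ M * ‖f (slice J z)‖ ≤ C := by
  obtain ⟨R, hR, hsub, a, ha, m, hm⟩ := h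
  have hmem : ∀ z, z ≠ w → ‖z - w‖ < R → slice J z ∈ Ω := fun z hz hzR =>
    hsub ((slice_mem_sigmaShell hJ).2 ⟨hz, hzR⟩)
  have hsum : ∀ z, z ≠ w → ‖z - w‖ < R →
      HasSum (fun n : ℤ => slice J ((z - w) ^ n) * a n) (f (slice J z)) := by
    intro z hz hzR
    -- The conjugate point is never in the shell: by symmetry of `Ω` that would put `w` itself in
    -- the domain.
    have hzw : z ≠ conj w := by
      rintro rfl
      apply hw
      have := hΩ.conj_mem hJ (hmem _ hz hzR)
      rwa [Complex.conj_conj] at this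
    have := ha _ ((slice_mem_sigmaShell hJ).2 ⟨hz, hzR⟩) (by
      rw [star_slice hJ]; exact fun h => hzw (slice_injective hJ h))
    simpa only [starZPow_slice hJ hzw] using this
  set r : ℝ := R / 2
  have hr : 0 < r := by positivity
  have hb := (hsum (w + r) (by simp [hr.ne']) (by
    rw [add_sub_cancel_left, Complex.norm_real, Real.norm_of_nonneg hr.le]
    exact half_lt_self hR)).summable.norm
  simp only [add_sub_cancel_left, norm_mul, norm_slice hJ, norm_zpow, Complex.norm_real,
    Real.norm_of_nonneg hr.le] at hb
  refine ⟨r, hr, m, r ^ m * ∑' n : ℤ, r ^ n * ‖a n‖, fun z hz hzr => ?_⟩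
  have hzR : ‖z - w‖ < R := hzr.trans (half_lt_self hR)
  refine ⟨hmem z hz hzR, ?_⟩
  have hpos : 0 < ‖z - w‖ := norm_pos_iff.2 (sub_ne_zero.2 hz)
  have h1 := (hsum z hz hzR).mul_left (slice J ((z - w) ^ m))
  have h2 := h1.norm_le_of_bounded (hb.hasSum.mul_left (r ^ m)) fun n => ?_
  · rwa [norm_mul, norm_slice hJ, norm_pow] at h2
  · rw [norm_mul, norm_mul, norm_slice hJ, norm_slice hJ, norm_pow, norm_zpow, ← mul_assoc,
      ← mul_assoc]
    by_cases hn : (m : ℤ) < -n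
    · have := hm (-n) hn
      rw [neg_neg] at this
      rw [this]; simp
    · refine mul_le_mul_of_nonneg_right ?_ (norm_nonneg _)
      rw [← zpow_natCast, ← zpow_natCast, ← zpow_add₀ hpos.ne', ← zpow_add₀ hr.ne']
      exact zpow_le_zpow_left₀ (by omega) hpos.le hzr.le

lemma meromorphicAt_of_bounded {φ : ℂ → ℂ} {w : ℂ} {M : ℕ} {C : ℝ}
    (hd : ∀ᶠ z in 𝓝[≠] w, DifferentiableAt ℂ φ z)
    (hb : ∀ᶠ z in 𝓝[≠] w, ‖z - w‖ ^ M * ‖φ z‖ ≤ C) : MeromorphicAt φ w := by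
  -- The extra power makes the product tend to `0`, which is also its value at `w`; so it is
  -- continuous there whatever `φ w` is.
  refine ⟨M + 1, Complex.analyticAt_of_differentiable_on_punctured_nhds_of_continuousAt ?_ ?_⟩
  · filter_upwards [hd] with z hz
    exact DifferentiableAt.smul (f := φ) (c := fun z => (z - w) ^ (M + 1)) (by fun_prop) hz
  · rw [continuousAt_iff_punctured_nhds]
    simp only [sub_self, zero_pow (Nat.succ_ne_zero M), zero_smul]
    refine squeeze_zero_norm' (a := fun z => ‖z - w‖ * C) ?_ ?_
    · filter_upwards [hb] with z hz
      rw [norm_smul, norm_pow, pow_succ', mul_assoc]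
      exact mul_le_mul_of_nonneg_left hz (norm_nonneg _)
    · have : ContinuousAt (fun z : ℂ => ‖z - w‖ * C) w := by fun_prop
      have h := this.tendsto.mono_left (nhdsWithin_le_nhds (s := {w}ᶜ))
      simpa using h

lemma eventually_punctured_of_ball {P : ℂ → Prop} {w : ℂ} {R : ℝ} (hR : 0 < R)
    (h : ∀ z, z ≠ w → ‖z - w‖ < R → P z) : ∀ᶠ z in 𝓝[≠] w, P z := by
  filter_upwards [self_mem_nhdsWithin, nhdsWithin_le_nhds (Metric.ball_mem_nhds w hR)] with z hz hz'
  exact h z hz (by rwa [Metric.mem_ball, dist_eq_norm] at hz')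

lemma IsSemiregularOn.eventually_mem (hf : IsSemiregularOn f Ω' Ω) (hJ : J ∈ imagUnits) {w : ℂ}
    (hw : slice J w ∈ Ω) : ∀ᶠ z in 𝓝[≠] w, z ∈ sliceSet J Ω' := by
  by_cases h : slice J w ∈ Ω'
  · exact nhdsWithin_le_nhds ((hf.domain.slice_isOpen J hJ).mem_nhds h)
  · obtain ⟨R, hR, M, C, hb⟩ := (hf.isPole _ ⟨hw, h⟩).exists_bound hJ hf.domain.symmetric h
    exact eventually_punctured_of_ball hR fun z hz hz' => (hb z hz hz').1

lemma IsSemiregularOn.meromorphicAt_halfStem (hf : IsSemiregularOn f Ω' Ω) (hJ : J ∈ imagUnits)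
    {w : ℂ} (hw : slice J w ∈ Ω) (i : Fin 4) :
    MeromorphicAt (fun z => halfStem J i (f (slice J z))) w := by
  have hD := hf.domain.slice_isOpen J hJ
  by_cases h : slice J w ∈ Ω'
  · have hd : DifferentiableOn ℂ (fun z => halfStem J i (f (slice J z))) (sliceSet J Ω') :=
      fun z hz => (hf.regular.differentiableAt_halfStem hJ hD i hz).differentiableWithinAt
    exact (hd.analyticAt (hD.mem_nhds h)).meromorphicAt
  · obtain ⟨R, hR, M, C, hb⟩ := (hf.isPole _ ⟨hw, h⟩).exists_bound hJ hf.domain.symmetric h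
    refine meromorphicAt_of_bounded (M := M) (C := ‖(halfStem J i).toContinuousLinearMap‖ * C)
      ?_ (eventually_punctured_of_ball hR fun z hz hz' => ?_)
    · filter_upwards [hf.eventually_mem hJ hw] with z hz
      exact hf.regular.differentiableAt_halfStem hJ hD i hz
    · have h1 := (halfStem J i).toContinuousLinearMap.le_opNorm (f (slice J z))
      calc ‖z - w‖ ^ M * ‖halfStem J i (f (slice J z))‖
          ≤ ‖z - w‖ ^ M * (‖(halfStem J i).toContinuousLinearMap‖ * ‖f (slice J z)‖) :=
            mul_le_mul_of_nonneg_left h1 (by positivity)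
        _ = ‖(halfStem J i).toContinuousLinearMap‖ * (‖z - w‖ ^ M * ‖f (slice J z)‖) := by ring
        _ ≤ _ := mul_le_mul_of_nonneg_left (hb z hz hz').2 (ContinuousLinearMap.opNorm_nonneg _)

/-- The stem function mixes the lines of `J` and `-J`, so the behaviour of `f` at both `p` and `star
p` enters; symmetry of `Ω` supplies the second point. -/
lemma IsSemiregularOn.meromorphicAt_stemOf (hf : IsSemiregularOn f Ω' Ω) (hΩ : IsSymmetric Ω)
    (hJ : J ∈ imagUnits) {w : ℂ} (hw : slice J w ∈ Ω) (i : Fin 4) :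
    MeromorphicAt (fun z => coord i (stemOf f J z)) w := by
  simp only [coord_stemOf]
  have hJ' := neg_mem_imagUnits hJ
  exact (hf.meromorphicAt_halfStem hJ hw i).add
    (hf.meromorphicAt_halfStem hJ' (hΩ.slice_mem hJ hJ' hw) i)

/-! ### Poles of the stem function are poles of the induced function -/

lemma exists_pow_mul_analyticAt {ι : Type*} [Fintype ι] {φ : ι → ℂ → ℂ} {w : ℂ}
    (h : ∀ i, MeromorphicAt (φ i) w) :
    ∃ M : ℕ, ∀ N ≥ M, ∀ i, AnalyticAt ℂ (fun z => (z - w) ^ N * φ i z) w := by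
  choose m hm using h
  refine ⟨∑ i, m i, fun N hN i => ?_⟩
  have hi : m i ≤ N := (Finset.single_le_sum (fun _ _ => Nat.zero_le _) (Finset.mem_univ i)).trans hN
  have h1 : AnalyticAt ℂ (fun z => (z - w) ^ (N - m i) * ((z - w) ^ m i • φ i z)) w :=
    AnalyticAt.mul (by fun_prop) (hm i)
  refine h1.congr (Eventually.of_forall fun z => ?_)
  simp only [smul_eq_mul]
  rw [← mul_assoc, ← pow_add, Nat.sub_add_cancel hi]

lemma hasSum_of_eq {ι E : Type*} [AddCommMonoid E] [TopologicalSpace E] {φ ψ : ι → E} {a b : E}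
    (h : HasSum φ a) (hφ : ∀ n, ψ n = φ n) (hb : b = a) : HasSum ψ b := by
  rw [hb, funext hφ]; exact h

/-- At a real `w` the symmetry of `F` allows the coefficients to be taken in `ℍ`. Their evaluation
then does not depend on the unit, so one expansion serves all the lines through `w`. -/
lemma exists_laurent (hsymm : ∀ z ∈ D, F (conj z) = cconj (F z)) {w : ℂ}
    (hD : ∀ᶠ z in 𝓝[≠] w, z ∈ D) (hF : ∀ i, MeromorphicAt (fun z => coord i (F z)) w) :
    ∃ R > 0, ∃ (M : ℕ) (c : ℕ → ℍ[ℂ]), (w.im = 0 → ∀ n, imPart (c n) = 0) ∧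
      ∀ z, z ≠ w → ‖z - w‖ < R → z ∈ D ∧ ∀ i,
        HasSum (fun n => coord i (c n) * (z - w) ^ n) ((z - w) ^ M * coord i (F z)) := by
  obtain ⟨M, hM⟩ := exists_pow_mul_analyticAt hF
  have h1 : ∀ᶠ z in 𝓝 w, ∀ i, DifferentiableAt ℂ (fun z => (z - w) ^ M * coord i (F z)) z :=
    eventually_all.2 fun i => (hM M le_rfl i).eventually_analyticAt.mono
      fun z hz => hz.differentiableAt
  obtain ⟨R, hR, hball⟩ := Metric.eventually_nhds_iff_ball.1
    (h1.and (eventually_nhdsWithin_iff.1 hD))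
  have hmem : ∀ z, z ≠ w → ‖z - w‖ < R → z ∈ D := fun z hz hz' =>
    (hball z (by rwa [Metric.mem_ball, dist_eq_norm])).2 hz
  have hc : ∀ i, ∃ c : ℕ → ℂ, ∀ z, ‖z - w‖ < R →
      HasSum (fun n => c n * (z - w) ^ n) ((z - w) ^ M * coord i (F z)) := by
    intro i
    have hd : DifferentiableOn ℂ (fun z => (z - w) ^ M * coord i (F z)) (Metric.ball w R) :=
      fun z hz => ((hball z hz).1 i).differentiableWithinAt
    refine ⟨fun n => (n.factorial : ℂ)⁻¹ *
      iteratedDeriv n (fun z => (z - w) ^ M * coord i (F z)) w, fun z hz => ?_⟩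
    have := Complex.hasSum_taylorSeries_on_ball hd
      (z := z) (by rwa [Metric.mem_ball, dist_eq_norm])
    refine hasSum_of_eq this (fun n => ?_) rfl
    simp only [smul_eq_mul]
    ring
  choose c hc using hc
  by_cases hw : w.im = 0
  · have hwc : conj w = w := Complex.conj_eq_iff_im.2 hw
    refine ⟨R, hR, M, fun n => (Quaternion.equivTuple ℂ).symm fun i => ((c i n).re : ℂ),
      fun _ n => ?_, fun z hz hzR => ⟨hmem z hz hzR, fun i => ?_⟩⟩
    · have h0 : ∀ r : ℝ, (r : ℂ).im = 0 := Complex.ofReal_im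
      ext
      exacts [h0 (c 0 n).re, h0 (c 1 n).re, h0 (c 2 n).re, h0 (c 3 n).re]
    · have h2 := hc i (conj z) (by rwa [← hwc, ← map_sub, RCLike.norm_conj])
      rw [hsymm z (hmem z hz hzR), coord_cconj] at h2
      have h3 := (Complex.conjCLE : ℂ ≃L[ℝ] ℂ).hasSum'.2 h2
      -- Averaging the expansion with its conjugate replaces each coefficient by its real part.
      have h4 := ((hc i z hzR).add h3).mul_left 2⁻¹
      refine hasSum_of_eq h4 (fun n => ?_) ?_
      · rw [coord_equivTuple_symm, Complex.re_eq_add_conj]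
        simp [hwc]
        ring
      · simp [hwc]
        ring
  · refine ⟨R, hR, M, fun n => (Quaternion.equivTuple ℂ).symm fun i => c i n,
      fun h => absurd h hw, fun z hz hzR => ⟨hmem z hz hzR, fun i => ?_⟩⟩
    simpa only [coord_equivTuple_symm] using hc i z hzR

lemma hasSum_ev (hJ : J ∈ imagUnits) {c : ℕ → ℍ[ℂ]} {b : ℕ → ℂ} {v : ℍ[ℂ]}
    (h : ∀ i, HasSum (fun n => b n * coord i (c n)) (coord i v)) :
    HasSum (fun n => slice J (b n) * ev J (c n)) (ev J v) := by
  have h1 := hasSum_sum (s := Finset.univ) fun i _ =>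
    ((sliceCLM J).hasSum (h i)).mul_right (stdBasis i)
  simp only [sliceCLM_apply] at h1
  rw [← ev_eq_sum] at h1
  refine hasSum_of_eq h1 (fun n => ?_) rfl
  rw [ev_eq_sum, Finset.mul_sum]
  simp only [slice_mul hJ, mul_assoc]

/-- The points of a small shell around `p` all lie on one line through `p`, or `p` is real. -/
lemma exists_slice_of_mem_sigmaShell (hJ : J ∈ imagUnits) {w : ℂ} {R : ℝ}
    (hR : w.im ≠ 0 → R ≤ |w.im|) {q : ℍ} (hq : q ∈ sigmaShell (slice J w) 0 R) :
    ∃ K ∈ imagUnits, (w.im = 0 ∨ K = J) ∧ slice K w = slice J w ∧ ∃ z, q = slice K z := by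
  by_cases hw : w.im = 0
  · obtain ⟨K, hK, h⟩ := exists_slice q
    exact ⟨K, hK, Or.inl hw, by simp [slice, hw], _, h.symm⟩
  refine ⟨J, hJ, Or.inr rfl, rfl, ?_⟩
  by_cases hsame : SameLine q (slice J w)
  · obtain ⟨K, hK, ⟨z, rfl⟩, ⟨w', hw'⟩⟩ := hsame
    have h1 := congrArg Quaternion.im hw'
    rw [slice_im hK, slice_im hJ] at h1
    have h2 := congrArg norm h1
    rw [norm_smul, norm_smul, norm_of_mem_imagUnits hK, norm_of_mem_imagUnits hJ, mul_one, mul_one,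
      Real.norm_eq_abs, Real.norm_eq_abs] at h2
    rcases abs_eq_abs.1 h2 with h3 | h3
    · rw [h3] at h1
      have : K = J := smul_right_injective _ hw h1
      exact ⟨z, by rw [this]⟩
    · rw [h3, neg_smul, ← smul_neg] at h1
      have : -K = J := smul_right_injective _ hw h1
      exact ⟨conj z, by rw [← this, slice_neg, Complex.conj_conj]⟩
  · exfalso
    have h1 := hq.2
    rw [sigma, if_neg hsame, norm_slice_im hJ] at h1
    -- Off a common line `σ` is at least `|Im p|`, which is at least `R`.
    have h2 : |w.im| ≤ √((q.re - (slice J w).re) ^ 2 + (‖q.im‖ + |w.im|) ^ 2) := by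
      refine Real.le_sqrt_of_sq_le ?_
      nlinarith [sq_nonneg (q.re - (slice J w).re), norm_nonneg q.im, abs_nonneg w.im,
        mul_nonneg (norm_nonneg q.im) (abs_nonneg w.im)]
    linarith [hR hw]

lemma isPole_of_meromorphicAt (hΩ : IsSymmetric Ω)
    (hg : ∀ K ∈ imagUnits, ∀ z ∈ sliceSet K Ω, g (slice K z) = ev K (G z))
    (hJ : J ∈ imagUnits) (hsymm : ∀ z ∈ sliceSet J Ω, G (conj z) = cconj (G z)) {w : ℂ}
    (hD : ∀ᶠ z in 𝓝[≠] w, z ∈ sliceSet J Ω)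
    (hG : ∀ i, MeromorphicAt (fun z => coord i (G z)) w) : IsPole g Ω (slice J w) := by
  obtain ⟨R, hR, M, c, hc, hsum⟩ := exists_laurent hsymm hD hG
  have hR' : ∃ R' > 0, R' ≤ R ∧ (w.im ≠ 0 → R' ≤ |w.im|) := by
    by_cases hw : w.im = 0
    · exact ⟨R, hR, le_rfl, fun h => absurd hw h⟩
    · exact ⟨min R |w.im|, lt_min hR (abs_pos.2 hw), min_le_left _ _, fun _ => min_le_right _ _⟩
  obtain ⟨R', hR'0, hR'R, hR'w⟩ := hR'
  have key : ∀ q ∈ sigmaShell (slice J w) 0 R', ∃ K ∈ imagUnits, (w.im = 0 ∨ K = J) ∧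
      slice K w = slice J w ∧ ∃ z, q = slice K z ∧ z ≠ w ∧ ‖z - w‖ < R ∧ z ∈ sliceSet K Ω := by
    intro q hq
    obtain ⟨K, hK, hwK, hKw, z, rfl⟩ := exists_slice_of_mem_sigmaShell hJ hR'w hq
    rw [← hKw, slice_mem_sigmaShell hK] at hq
    have hzR := hq.2.trans_le hR'R
    refine ⟨K, hK, hwK, hKw, z, rfl, hq.1, hzR, ?_⟩
    rw [hΩ.sliceSet_eq hK hJ]
    exact (hsum z hq.1 hzR).1
  refine ⟨R', hR'0, fun q hq => ?_,
    -- The coefficients are those of the Taylor series of `(z - w) ^ M * G`, shifted by `M`; the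
    -- guard makes `toNat` exact.
    fun k => if -(M : ℤ) ≤ k then ev J (c (k + M).toNat) else 0, fun q hq hq' => ?_, M,
    fun k hk => if_neg (by omega)⟩
  · obtain ⟨K, hK, -, -, z, rfl, -, -, hz⟩ := key q hq
    exact hz
  · obtain ⟨K, hK, hwK, hKw, z, rfl, hzw, hzR, hz⟩ := key q hq
    have hev : ∀ n, ev J (c n) = ev K (c n) := by
      rcases hwK with hw | rfl
      · intro n; rw [ev, ev, hc hw n, mul_zero, mul_zero]
      · exact fun n => rfl
    have hzw' : z ≠ conj w := by
      rintro rfl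
      exact hq' (by rw [← hKw, star_slice hK])
    have hz0 : z - w ≠ 0 := sub_ne_zero.2 hzw
    rw [hg K hK z hz, ← hKw]
    simp only [starZPow_slice hK hzw']
    have hinj : Function.Injective fun n : ℕ => (n : ℤ) - M := fun a b h => by
      simpa using h
    rw [← hinj.hasSum_iff]
    · have h1 : HasSum (fun n : ℕ => slice K ((z - w) ^ ((n : ℤ) - M)) * ev K (c n))
          (ev K (G z)) := by
        refine hasSum_ev hK fun i => ?_
        have h2 := ((hsum z hzw hzR).2 i).mul_left ((z - w) ^ (-(M : ℤ)))
        refine hasSum_of_eq h2 (fun n => ?_) ?_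
        · rw [sub_eq_add_neg (n : ℤ), add_comm (n : ℤ), zpow_add₀ hz0, zpow_natCast]; ring
        · rw [← mul_assoc, zpow_neg, zpow_natCast, inv_mul_cancel₀ (pow_ne_zero _ hz0), one_mul]
      refine hasSum_of_eq h1 (fun n => ?_) rfl
      simp [hev]
    · intro k hk
      rw [if_neg, mul_zero]
      intro h
      exact hk ⟨(k + M).toNat, by simp only; omega⟩

end

/-! ### Return from stem functions to semiregular functions -/

section

variable {D : Set ℂ} {F G : ℂ → ℍ[ℂ]} {x y : ℝ} {Ω Ω' Ω'' : Set ℍ} {f g : ℍ → ℍ} {J K : ℍ}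

/-! ### Adjoining a sphere to a symmetric slice domain -/

lemma slice_mem_sphere_iff (hJ : J ∈ imagUnits) {z : ℂ} :
    slice J z ∈ sphere x y ↔ z = ⟨x, y⟩ ∨ z = conj ⟨x, y⟩ := by
  constructor
  · rintro ⟨K, hK, h⟩
    change slice J z = slice K ⟨x, y⟩ at h
    have h1 := congrArg coordOf h
    rw [coordOf_slice hJ, coordOf_slice hK] at h1
    have hre : z.re = x := congrArg Complex.re h1
    rcases abs_eq_abs.1 (congrArg Complex.im h1) with him | him
    · exact Or.inl (Complex.ext hre him)
    · exact Or.inr (Complex.ext hre him)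
  · rintro (rfl | rfl)
    · exact slice_mem_sphere hJ
    · rw [← slice_neg]
      exact slice_mem_sphere (neg_mem_imagUnits hJ)

lemma sliceSet_union_sphere (hJ : J ∈ imagUnits) :
    sliceSet J (Ω' ∪ sphere x y) = sliceSet J Ω' ∪ {⟨x, y⟩, conj ⟨x, y⟩} := by
  ext z
  change (slice J z ∈ Ω' ∨ slice J z ∈ sphere x y) ↔ _
  rw [slice_mem_sphere_iff hJ]
  rfl

lemma isSymmetric_sphere (x y : ℝ) : IsSymmetric (sphere x y) := by
  rintro u v J hJ h q ⟨K, hK, rfl⟩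
  exact (slice_mem_sphere_iff hK (z := ⟨u, v⟩)).2
    ((slice_mem_sphere_iff hJ (z := ⟨u, v⟩)).1 h)

lemma IsSymmetric.union {S T : Set ℍ} (hS : IsSymmetric S) (hT : IsSymmetric T) :
    IsSymmetric (S ∪ T) := fun u v J hJ h =>
  h.elim (fun h => (hS u v J hJ h).trans Set.subset_union_left)
    (fun h => (hT u v J hJ h).trans Set.subset_union_right)

lemma continuous_coordOf : Continuous coordOf :=
  Complex.equivRealProdCLM.symm.continuous.comp
    (Quaternion.continuous_re.prodMk Quaternion.continuous_im.norm)

lemma continuous_slice (J : ℍ) : Continuous (slice J) := by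
  have : slice J = sliceCLM J := funext fun z => (sliceCLM_apply J z).symm
  rw [this]
  exact (sliceCLM J).continuous

lemma isOpen_union_of_eventually {X : Type*} [TopologicalSpace X] {U T : Set X} (hU : IsOpen U)
    (h : ∀ w ∈ T, ∀ᶠ z in 𝓝[≠] w, z ∈ U) : IsOpen (U ∪ T) := by
  rw [isOpen_iff_mem_nhds]
  rintro w (hw | hw)
  · exact mem_of_superset (hU.mem_nhds hw) Set.subset_union_left
  · filter_upwards [eventually_nhdsWithin_iff.1 (h w hw)] with z hz
    by_cases hzw : z = w
    · exact Or.inr (hzw ▸ hw)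
    · exact Or.inl (hz hzw)

/-- In each slice the sphere adds at most two points, each with a punctured neighbourhood inside
`Ω'`. So openness persists, and the new points lie in the closure, which preserves connectedness. -/
lemma IsSemiregularOn.isSymmetricSliceDomain_union_sphere (hf : IsSemiregularOn f Ω' Ω)
    (hxy : sphere x y ⊆ Ω) : IsSymmetricSliceDomain (Ω' ∪ sphere x y) := by
  have hmem : ∀ J ∈ imagUnits, ∀ w : ℂ, w ∈ ({⟨x, y⟩, conj ⟨x, y⟩} : Set ℂ) →
      ∀ᶠ z in 𝓝[≠] w, z ∈ sliceSet J Ω' := fun J hJ w hw =>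
    hf.eventually_mem hJ (hxy ((slice_mem_sphere_iff hJ).2 hw))
  have hsymm := hf.domain.symmetric.union (isSymmetric_sphere x y)
  have hopen : ∀ J ∈ imagUnits, IsOpen (sliceSet J (Ω' ∪ sphere x y)) := fun J hJ => by
    rw [sliceSet_union_sphere hJ]
    exact isOpen_union_of_eventually (hf.domain.slice_isOpen J hJ) (hmem J hJ)
  have hcl : ∀ J ∈ imagUnits, ∀ w : ℂ, w ∈ ({⟨x, y⟩, conj ⟨x, y⟩} : Set ℂ) →
      w ∈ closure (sliceSet J Ω') := fun J hJ w hw =>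
    mem_closure_iff_frequently.2
      (((hmem J hJ w hw).frequently).filter_mono nhdsWithin_le_nhds)
  refine ⟨?_, ?_, ?_, hopen, fun J hJ => ?_, hsymm⟩
  · have : Ω' ∪ sphere x y = coordOf ⁻¹' sliceSet unitI (Ω' ∪ sphere x y) :=
      Set.ext fun q => (hsymm.coordOf_mem unitI_mem).symm
    rw [this]
    exact (hopen _ unitI_mem).preimage continuous_coordOf
  · refine hf.domain.isConnected.subset_closure Set.subset_union_left
      (Set.union_subset subset_closure ?_)
    rintro _ ⟨J, hJ, rfl⟩
    exact map_mem_closure (f := slice J) (continuous_slice J) (hcl J hJ _ (Or.inl rfl))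
      fun z hz => hz
  · obtain ⟨r, hr⟩ := hf.domain.meets_real
    exact ⟨r, Or.inl hr⟩
  · rw [sliceSet_union_sphere hJ]
    exact (hf.domain.slice_isConnected J hJ).subset_closure Set.subset_union_left
      (Set.union_subset subset_closure (hcl J hJ))

/-! ### Existence -/

lemma exists_quad_pow_smul_isStemOn (hf : IsSemiregularOn f Ω' Ω) (hΩ : IsSymmetric Ω)
    (hJ : J ∈ imagUnits) (hxy : sphere x y ⊆ Ω) :
    ∃ M : ℕ, IsStemOn (fun z => quad x y z ^ M • stemOf f J z) (sliceSet J (Ω' ∪ sphere x y)) ∧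
      ∀ z ∈ sliceSet J Ω', quad x y z ^ M ≠ 0 := by
  have hF := hf.regular.isStemOn_stemOf hf.domain hJ
  have hD := hf.domain.slice_isOpen J hJ
  by_cases h0 : (⟨x, y⟩ : ℂ) ∈ sliceSet J Ω'
  · refine ⟨0, ?_, fun _ _ => by simp⟩
    have : sliceSet J (Ω' ∪ sphere x y) = sliceSet J Ω' := by
      rw [sliceSet_union_sphere hJ, Set.union_eq_left, Set.insert_subset_iff,
        Set.singleton_subset_iff]
      exact ⟨h0, hf.domain.symmetric.conj_mem hJ h0⟩
    rw [this]
    simpa using hF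
  · have hw : ∀ w : ℂ, w = ⟨x, y⟩ ∨ w = conj ⟨x, y⟩ → ∃ M : ℕ, ∀ N ≥ M, ∀ i,
        AnalyticAt ℂ (fun z => (z - w) ^ N * coord i (stemOf f J z)) w := fun w hw =>
      exists_pow_mul_analyticAt fun i =>
        hf.meromorphicAt_stemOf hΩ hJ (hxy ((slice_mem_sphere_iff hJ).2 hw)) i
    obtain ⟨M₁, hM₁⟩ := hw _ (Or.inl rfl)
    obtain ⟨M₂, hM₂⟩ := hw _ (Or.inr rfl)
    refine ⟨M₁ + M₂, ⟨fun i => ?_, fun z _ => ?_⟩, fun z hz => pow_ne_zero _ fun h => ?_⟩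
    · rw [sliceSet_union_sphere hJ]
      simp only [coord_smul]
      rintro z (hz | rfl | rfl)
      · exact (((differentiable_quad x y z).pow _).mul
          ((hF.diff i).differentiableAt (hD.mem_nhds hz))).differentiableWithinAt
      · have h1 := (hM₁ (M₁ + M₂) (Nat.le_add_right _ _) i).differentiableAt
        have h2 : DifferentiableAt ℂ (fun z : ℂ => (z - conj ⟨x, y⟩) ^ (M₁ + M₂)) ⟨x, y⟩ := by
          fun_prop
        refine DifferentiableAt.differentiableWithinAt ((h2.mul h1).congr_of_eventuallyEq
          (Eventually.of_forall fun z => ?_))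
        simp only [Pi.mul_apply, quad_eq, mul_pow]; ring
      · have h1 := (hM₂ (M₁ + M₂) (Nat.le_add_left _ _) i).differentiableAt
        have h2 : DifferentiableAt ℂ (fun z : ℂ => (z - ⟨x, y⟩) ^ (M₁ + M₂)) (conj ⟨x, y⟩) := by
          fun_prop
        refine DifferentiableAt.differentiableWithinAt ((h2.mul h1).congr_of_eventuallyEq
          (Eventually.of_forall fun z => ?_))
        simp only [Pi.mul_apply, quad_eq, mul_pow]; ring
    · rw [quad_conj, stemOf_conj, cconj_smul, map_pow]
    · rcases quad_eq_zero.1 h with rfl | rfl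
      · exact h0 hz
      · apply h0
        have := hf.domain.symmetric.conj_mem hJ hz
        rwa [Complex.conj_conj] at this

/-- Local vanishing of the norm spreads over the slice. On the real axis the norm is `p² |f|²` with
`p ≠ 0` on `Ω'`, so `f` vanishes at the real points and then everywhere on `Ω'`. -/
lemma normSq_not_eventually_zero (hf : IsRegularOn f Ω') (hΩ' : IsSymmetricSliceDomain Ω')
    (hΩ'' : IsSymmetricSliceDomain Ω'') (hsub : Ω' ⊆ Ω'') (hf0 : ∃ q ∈ Ω', f q ≠ 0)
    (hJ : J ∈ imagUnits) {p : ℂ → ℂ} (hp : ∀ z ∈ sliceSet J Ω', p z ≠ 0)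
    (hF : IsStemOn (fun z => p z • stemOf f J z) (sliceSet J Ω'')) {w : ℂ}
    (hw : w ∈ sliceSet J Ω'') :
    ¬ ∀ᶠ z in 𝓝 w, Quaternion.normSq (p z • stemOf f J z) = 0 := by
  intro h
  have hz := (hF.differentiableOn_normSq.analyticOnNhd
    (hΩ''.slice_isOpen J hJ)).eqOn_zero_of_preconnected_of_eventuallyEq_zero
    (hΩ''.slice_isConnected J hJ).isPreconnected hw h
  obtain ⟨r, hr⟩ := hΩ'.exists_real_mem J
  have h0 : IsStemOn (fun _ => (0 : ℍ[ℂ])) (sliceSet J Ω') :=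
    ⟨fun i => by fin_cases i <;> simp, fun _ _ => cconj_zero.symm⟩
  have hzero := (hf.isStemOn_stemOf hΩ' hJ).eqOn_of_eq_real (hΩ'.slice_isOpen J hJ)
    (hΩ'.slice_isConnected J hJ).isPreconnected hr h0 fun t ht => by
      have h1 : Quaternion.normSq (p t • stemOf f J t) = 0 := hz (hsub ht)
      rw [← Quaternion.coe_mul_eq_smul, map_mul, Quaternion.normSq_coe, stemOf_real,
        normSq_emb] at h1
      have h2 := (mul_eq_zero.1 h1).resolve_left (pow_ne_zero 2 (hp t ht))
      rw [Complex.ofReal_eq_zero, Quaternion.normSq_eq_zero] at h2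
      rw [stemOf_real, h2]
      ext <;> simp [emb] <;> rfl
  obtain ⟨q, hq, hfq⟩ := hf0
  obtain ⟨K, hK, h2⟩ := exists_slice q
  have hD : coordOf q ∈ sliceSet J Ω' := (hΩ'.symmetric.coordOf_mem hJ).2 hq
  apply hfq
  rw [← h2, ← ev_stemOf f hK, hf.stemOf_eq_stemOf hΩ' hJ hK hD, hzero _ hD]
  ext <;> simp [ev]

lemma quad_slice (hJ : J ∈ imagUnits) (z : ℂ) (m : ℤ) :
    ((slice J z - (x : ℍ)) ^ 2 + (y : ℍ) ^ 2) ^ m = slice J (quad x y z ^ m) := by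
  rw [← slice_ofReal J x, ← slice_ofReal J y]
  simp only [← sliceHom_apply hJ, quad, map_zpow₀, map_add, map_sub, map_pow]

lemma factorization_slice (hJ : J ∈ imagUnits) (z : ℂ) (m : ℤ) {n : ℕ} (p : Fin n → ℍ)
    (g : ℍ → ℍ) :
    ((slice J z - (x : ℍ)) ^ 2 + (y : ℍ) ^ 2) ^ m * starProd p g (slice J z) =
      ev J (quad x y z ^ m • (prodL (List.ofFn p) z * stemOf g J z)) := by
  rw [quad_slice hJ, ev_smul hJ, ← ev_stemOf (starProd p g) hJ, stemOf_starProd p g hJ]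

/-- Multiplying by `star (prodL l z)` turns the linear factors into `quad ^ l.length`, so `G` is
obtained from `F` by scalar division and cannot lose meromorphy. -/
lemma meromorphicAt_coord_of_factorization {w : ℂ} {M m : ℕ} {l : List ℍ}
    (hl : ∀ a ∈ l, a ∈ sphere x y) (hF : ∀ i, MeromorphicAt (fun z => coord i (F z)) w)
    (h : ∀ᶠ z in 𝓝[≠] w, quad x y z ^ M • F z = quad x y z ^ m • (prodL l z * G z)) (i : Fin 4) :
    MeromorphicAt (fun z => coord i (G z)) w := by
  have hq : ∀ k : ℕ, MeromorphicAt (fun z => quad x y z ^ k) w := fun k =>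
    (((differentiable_quad x y).analyticAt w).pow k).meromorphicAt
  have hP : ∀ i, MeromorphicAt (fun z => coord i (star (prodL l z))) w := by
    have h0 : ∀ i, MeromorphicAt (fun z => coord i (prodL l z)) w := fun i =>
      (((isStemOn_prodL l).diff i).analyticAt univ_mem).meromorphicAt
    intro i
    fin_cases i
    · simpa using h0 0
    · exact (h0 1).neg
    · exact (h0 2).neg
    · exact (h0 3).neg
  have h1 := ((hq (m + l.length)).inv.mul (hq M)).mul (coord_mul_induction
    (Q := fun φ => MeromorphicAt φ w) (fun _ _ h h' => h.add h') (fun _ _ h h' => h.sub h')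
    (fun _ _ h h' => h.mul h') hP hF i)
  refine h1.congr ?_
  filter_upwards [h, eventually_quad_ne_zero x y w] with z hz hqz
  have h2 : quad x y z ^ (m + l.length) • G z = quad x y z ^ M • (star (prodL l z) * F z) := by
    have h0 : ∀ (c : ℂ) (v w : ℍ[ℂ]), v * c • w = c • (v * w) := fun c v w => by
      ext <;> simp <;> ring
    rw [← h0, hz, h0, ← mul_assoc, Quaternion.star_mul_self,
      normSq_prodL hl, Quaternion.coe_mul_eq_smul, smul_smul, pow_add]
  have h3 := congrArg (coord i) h2
  rw [coord_smul, coord_smul] at h3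
  have h4 : quad x y z ^ (m + l.length) ≠ 0 := pow_ne_zero _ hqz
  simp only [Pi.mul_apply, Pi.inv_apply]
  rw [mul_assoc, ← h3, inv_mul_cancel_left₀ h4]

theorem exists_isFactorization (hΩ : IsSymmetric Ω) (hf : IsSemiregularOn f Ω' Ω)
    (hf0 : ∃ q ∈ Ω', f q ≠ 0) (hxy : sphere x y ⊆ Ω) :
    ∃ (m : ℤ) (n : ℕ) (p : Fin n → ℍ) (g : ℍ → ℍ) (Ω'' : Set ℍ),
      IsFactorization f Ω' Ω x y m n p g Ω'' := by
  have hJ := unitI_mem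
  set J := unitI
  have hdom := hf.isSymmetricSliceDomain_union_sphere hxy
  have hsub : Ω' ⊆ Ω' ∪ sphere x y := Set.subset_union_left
  have hw : (⟨x, y⟩ : ℂ) ∈ sliceSet J (Ω' ∪ sphere x y) := Or.inr (slice_mem_sphere hJ)
  obtain ⟨M, hM, hM0⟩ := exists_quad_pow_smul_isStemOn hf hΩ hJ hxy
  obtain ⟨m, l, G, hl, hG, hG0, hFG⟩ := exists_stem_factorization (hdom.slice_isOpen J hJ)
    (fun z hz => hdom.symmetric.conj_mem hJ hz) hw hM
    (normSq_not_eventually_zero hf.regular hf.domain hdom hsub hf0 hJ hM0 hM hw)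
  have hGK : ∀ K ∈ imagUnits, ∀ z ∈ sliceSet K (Ω' ∪ sphere x y),
      induced G (slice K z) = ev K (G z) := fun K hK z hz =>
    induced_slice hK (hG.map_conj z (by rwa [hdom.symmetric.sliceSet_eq hJ hK]))
  -- The power `M` that cleared the poles is subtracted back from the exponent found for the
  -- holomorphic stem.
  refine ⟨(m : ℤ) - M, l.length, l.get, induced G, Ω' ∪ sphere x y,
    ⟨fun i => hl.1 _ (List.get_mem l i), fun i hi => ?_, ⟨hdom, Set.union_subset hf.subset hxy, ?_, ?_⟩,
      hsub, Set.subset_union_right, ?_, ?_⟩⟩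
  · exact List.isChain_iff_getElem.1 hl.2 i hi
  · exact isRegularOn_of_stem hdom.slice_isOpen
      (fun K hK => by rwa [hdom.symmetric.sliceSet_eq hK hJ]) hGK
  · rintro p ⟨hp, -⟩
    obtain ⟨K, hK, h2⟩ := exists_slice p
    rw [← h2] at hp ⊢
    have hev := hf.eventually_mem hK hp
    have hpJ := hΩ.slice_mem hK hJ hp
    have hD : sliceSet K (Ω' ∪ sphere x y) = sliceSet J (Ω' ∪ sphere x y) :=
      hdom.symmetric.sliceSet_eq hK hJ
    refine isPole_of_meromorphicAt hdom.symmetric hGK hK (fun z hz => hG.map_conj z (hD ▸ hz))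
      (hev.mono fun z hz => hsub hz)
      (meromorphicAt_coord_of_factorization (M := M) (m := m) hl.1 (fun i => hf.meromorphicAt_stemOf hΩ hJ hpJ i) ?_)
    filter_upwards [hev] with z hz
    exact hFG z (hD ▸ hsub hz)
  · rintro _ ⟨K, hK, rfl⟩
    change induced G (slice K ⟨x, y⟩) ≠ 0
    rw [hGK K hK _ (Or.inr (slice_mem_sphere hK))]
    exact ev_ne_zero_of_normSq_ne_zero hK hG0
  · intro q hq
    obtain ⟨K, hK, h2⟩ := exists_slice q
    rw [← h2, factorization_slice hK, List.ofFn_get, ← ev_stemOf f hK]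
    rw [← h2] at hq
    set z := coordOf q
    have hzJ : z ∈ sliceSet J Ω' := hf.domain.symmetric.slice_mem hK hJ hq
    have hstem : stemOf (induced G) K z = G z := by
      refine stemOf_eq hK (hGK K hK z (hsub hq)) ?_
      rw [hGK K hK _ (hdom.symmetric.conj_mem hK (hsub hq)), hG.map_conj z (hsub hzJ)]
    rw [hf.regular.stemOf_eq_stemOf hf.domain hJ hK hzJ, hstem]
    congr 1
    have h3 := hFG z (hsub hzJ)
    have h4 : quad x y z ^ M • stemOf f J z =
        quad x y z ^ M • (quad x y z ^ ((m : ℤ) - M) • (prodL l z * G z)) := by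
      rw [h3, smul_smul]
      congr 1
      have h5 := hM0 z hzJ
      -- When `M = 0` the value of `quad` may be zero, so exponents may be added only in the other
      -- case.
      rcases eq_or_ne M 0 with rfl | hM
      · simp
      · rw [← zpow_natCast, ← zpow_natCast, ← zpow_add₀ ((pow_ne_zero_iff hM).1 h5)]
        congr 1; ring
    exact smul_right_injective _ (hM0 z hzJ) h4

/-! ### Uniqueness -/

lemma IsFactorization.stem {m : ℤ} {n : ℕ} {p : Fin n → ℍ}
    (h : IsFactorization f Ω' Ω x y m n p g Ω'') (hΩ' : IsSymmetric Ω') (hJ : J ∈ imagUnits) :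
    IsRootList x y (List.ofFn p) ∧ (∀ i, ContinuousAt (fun z => coord i (stemOf g J z)) ⟨x, y⟩) ∧
      Quaternion.normSq (stemOf g J ⟨x, y⟩) ≠ 0 ∧
      ∀ z ∈ sliceSet J Ω',
        stemOf f J z = quad x y z ^ m • (prodL (List.ofFn p) z * stemOf g J z) := by
  have hs := h.semiregular
  have hw : (⟨x, y⟩ : ℂ) ∈ sliceSet J Ω'' := h.no_poles (slice_mem_sphere hJ)
  refine ⟨⟨fun a ha => ?_, List.isChain_iff_getElem.2 fun i hi => ?_⟩,
    (hs.regular.isStemOn_stemOf hs.domain hJ).continuousAt_coord (hs.domain.slice_isOpen J hJ) hw,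
    fun h0 => ?_, fun z hz => stemOf_eq hJ ?_ ?_⟩
  · obtain ⟨i, rfl⟩ := List.mem_ofFn.1 ha
    exact h.mem_sphere i
  · simpa using h.ne_conj i (by simpa using hi)
  -- A vanishing norm would give a zero of `g` on the sphere, possibly on another line; the stem
  -- function does not depend on the line.
  · obtain ⟨K, hK, hev⟩ := exists_ev_eq_zero h0
    rw [← hs.regular.stemOf_eq_stemOf hs.domain hJ hK hw, ev_stemOf g hK] at hev
    exact h.no_zeros _ (slice_mem_sphere hK) hev
  · rw [h.eq _ hz, factorization_slice hJ]
  · rw [h.eq _ (hΩ'.conj_mem hJ hz), factorization_slice hJ, stemOf_conj, quad_conj, cconj_smul,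
      cconj_mul, (isStemOn_prodL (D := Set.univ) _).map_conj z (Set.mem_univ z), map_zpow₀]

theorem IsFactorization.unique (hf : IsSemiregularOn f Ω' Ω) (hxy : sphere x y ⊆ Ω)
    {m k : ℤ} {n n' : ℕ} {p : Fin n → ℍ} {p' : Fin n' → ℍ} {g' : ℍ → ℍ} {Ω₁ Ω₂ : Set ℍ}
    (h : IsFactorization f Ω' Ω x y m n p g Ω₁) (h' : IsFactorization f Ω' Ω x y k n' p' g' Ω₂) :
    m = k ∧ n = n' ∧ ∀ (h0 : 0 < n) (h0' : 0 < n'), p ⟨0, h0⟩ = p' ⟨0, h0'⟩ := by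
  obtain ⟨hl, hG, hG0, hFG⟩ := h.stem hf.domain.symmetric unitI_mem
  obtain ⟨hl', hG', hG0', hFG'⟩ := h'.stem hf.domain.symmetric unitI_mem
  obtain ⟨hmk, hlen, hhead⟩ := stem_factorization_unique rfl hl hl' hG hG' hG0 hG0' (by
    filter_upwards [hf.eventually_mem unitI_mem (hxy (slice_mem_sphere unitI_mem))] with z hz
    rw [← hFG z hz, hFG' z hz])
  rw [List.length_ofFn, List.length_ofFn] at hlen
  refine ⟨hmk, hlen, fun h0 h0' => ?_⟩
  rw [List.head?_eq_getElem?, List.head?_eq_getElem?, List.getElem?_eq_getElem (by simpa using h0),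
    List.getElem?_eq_getElem (by simpa using h0')] at hhead
  simpa using hhead

end

end SliceRegular

end

/-! ### Existence of the factorization, with order and multiplicity read off from any one of them -/

theorem mainTheorem10 (Ω : Set ℍ) (hΩ : SliceRegular.IsSymmetricSliceDomain Ω)
    (f : ℍ → ℍ) (Ω' : Set ℍ) (hf : SliceRegular.IsSemiregularOn f Ω' Ω)
    (hf0 : ∃ q ∈ Ω', f q ≠ 0)
    (x y : ℝ) (hxy : SliceRegular.sphere x y ⊆ Ω) :
    ∃ (m : ℤ) (n : ℕ) (p : Fin n → ℍ),
      (∃ (g : ℍ → ℍ) (Ω'' : Set ℍ), SliceRegular.IsFactorization f Ω' Ω x y m n p g Ω'') ∧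
      (∀ k : ℤ, SliceRegular.HasSphericalOrder f Ω' Ω x y k ↔ m ≤ 0 ∧ k = -2 * m) ∧
      (∀ (k : ℕ) (p₁ : ℍ), SliceRegular.HasIsolatedMultiplicity f Ω' Ω x y k p₁ ↔
        ∃ h : 0 < n, k = n ∧ p₁ = p ⟨0, h⟩) := by
  obtain ⟨m, n, p, g, Ω'', h⟩ := SliceRegular.exists_isFactorization hΩ.symmetric hf hf0 hxy
  refine ⟨m, n, p, ⟨g, Ω'', h⟩, fun k => ⟨?_, fun hk => ⟨m, n, p, g, Ω'', h, hk⟩⟩,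
    fun k p₁ => ⟨?_, ?_⟩⟩
  · rintro ⟨m', n', p', g', Ω₂, h', hm', rfl⟩
    rw [(h.unique hf hxy h').1]
    exact ⟨hm', rfl⟩
  · rintro ⟨m', p', g', Ω₂, h', hk, rfl⟩
    obtain ⟨-, rfl, hp⟩ := h.unique hf hxy h'
    exact ⟨hk, rfl, (hp hk hk).symm⟩
  · rintro ⟨h0, rfl, rfl⟩
    exact ⟨m, p, g, Ω'', h, h0, rfl⟩
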